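/- **Definitions.** Let $\Sigma$ be a CAT(0) space. A *block decomposition* of $\Sigma$ is a collection $\mathcal B$ of closed convex subsets (*blocks*) that covers $\Sigma$. Its *walls* are the non-empty intersections of two distinct blocks. Its *adjacency graph* $\mathcal T$ has the blocks as vertices and an edge between any two distinct blocks with non-empty intersection. The decomposition is *treelike* if $\mathcal T$ is a simplicial tree and there is $d_{\mathcal W}>0$ such that any two distinct walls have distance at least $d_{\mathcal W}$. An edge $\{B,B'\}$ of $\mathcal T$ is identified with the wall $B\cap B'$. A *geodesic ray* is an isometric embedding $\gamma:[0,\infty)\to\Sigma$; two rays are asymptotic if they stay at bounded distance, and $\gamma(\infty)$ denotes the asymptotic class of $\gamma$. If a geodesic segment from $x$ to $y$ does not start in a wall, its *itinerary* is the shortest path in $\mathcal T$ from the block containing $x$ to a block containing $y$. If $\gamma$ is a geodesic ray that does not start in a wall, its *itinerary* $I(\gamma)$ is defined as follows. If $\gamma$ eventually stays in one block, $I(\gamma)$ is the itinerary of $\gamma|_{[0,t]}$ for all sufficiently large $t$. Otherwise $I(\gamma)$ is the infinite path $(B_1,B_2,\dots)$ in $\mathcal T$ for which there are times $0<t_1<t_2<\dots$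 such that, for every $i$, $(B_1,\dots,B_i)$ is the itinerary of $\gamma|_{[0,t_i]}$ and $\gamma(t_i)$ lies in $B_i$ but in no wall contained in $B_i$. Fix a basepoint $p\in\Sigma$. The *visual boundary* $\partial\Sigma$ is the set of asymptotic classes of geodesic rays, with the topology transported from the cone topology on the set of rays starting at $p$, whose basic open sets are $\{\gamma : d(\alpha(t),\gamma(t))<\varepsilon \text{ for all } t\le r\}$ for a ray $\alpha$ from $p$, $r\ge 0$ and $\varepsilon>0$. For a function $M:[1,\infty)\times[0,\infty)\to[0,\infty)$, a geodesic ray $\gamma$ is *$M$-Morse* if every $(K,L)$-quasi-geodesic with endpoints on $\gamma$ is contained in the $M(K,L)$-neighbourhood of $\gamma$, and it is *Morse* if it is $M$-Morse for some $M$. The *Morse boundary* $\partial_M\Sigma$ is the set of classes of Morse geodesic rays; a set $U\subseteq\partial_M\Sigma$ is open if and only if, for every $M$, the set of $M$-Morse rays from $p$ whose class is in $U$ is open in the space of $M$-Morse rays from $p$ with the compact-open topology. **Proposition (cutset property).** Let $\Sigma$ be a complete separable CAT(0) space with a treelike block decomposition $\mathcal B$, and let $p\in\Sigma$ be a basepoint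 that does not lie in a wall. Let $\kappa$ be a connected component of $\partial\Sigma$ that contains two distinct boundary points $\gamma_1(\infty)$ and $\gamma_2(\infty)$, where $\gamma_1$ and $\gamma_2$ are the representatives starting at $p$. Then for every wall $W$ that occurs in exactly one of the itineraries $I(\gamma_1)$ and $I(\gamma_2)$ there is a geodesic ray $\gamma\subseteq W$ such that $\gamma(\infty)\in\kappa$. The same holds with $\partial_M\Sigma$ in place of $\partial\Sigma$. -/

import Mathlib

open Set Topology
open scoped NNReal

noncomputable section

namespace Treelike

universe u

/-! ### CAT(0) spaces, convex sets -/

section Basic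

variable {X : Type u} [MetricSpace X]

/-- `c`, restricted to `[0, dist x y]`, is a geodesic segment from `x` to `y`. -/
structure IsGeodesicSegment (c : ℝ → X) (x y : X) : Prop where
  left : c 0 = x
  right : c (dist x y) = y
  isom : ∀ s ∈ Icc 0 (dist x y), ∀ t ∈ Icc 0 (dist x y), dist (c s) (c t) = |s - t|

variable (X) in
/-- CAT(0) spaces: geodesic metric spaces in which every geodesic triangle is at least as thin as
its comparison triangle in the Euclidean plane. The points compared lie on the two sides issuing
from the vertex `x`; every vertex of a triangle can play the role of `x`. Here `x' y' z'` is the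
comparison triangle of `x y z`, and `a'`, `b'` are the comparison points of `c s`, `e t`. -/
structure IsCAT0 : Prop where
  geodesic : ∀ x y : X, ∃ c : ℝ → X, IsGeodesicSegment c x y
  comparison : ∀ (x y z : X) (c e : ℝ → X), IsGeodesicSegment c x y → IsGeodesicSegment e x z →
    ∀ x' y' z' : EuclideanSpace ℝ (Fin 2),
      dist x' y' = dist x y → dist y' z' = dist y z → dist x' z' = dist x z →
    ∀ s ∈ Icc 0 (dist x y), ∀ t ∈ Icc 0 (dist x z), ∀ a' b' : EuclideanSpace ℝ (Fin 2),
      dist x' a' = dist x (c s) → dist a' y' = dist (c s) y →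
      dist x' b' = dist x (e t) → dist b' z' = dist (e t) z →
      dist (c s) (e t) ≤ dist a' b'

/-- A set is convex if it contains every geodesic segment joining two of its points. -/
def IsGeodesicallyConvex (C : Set X) : Prop :=
  ∀ x ∈ C, ∀ y ∈ C, ∀ c : ℝ → X, IsGeodesicSegment c x y → ∀ s ∈ Icc 0 (dist x y), c s ∈ C

/-! ### Block decompositions -/

/-- A block decomposition: a cover by closed convex subsets. -/
structure IsBlockDecomposition (𝓑 : Set (Set X)) : Prop where
  closed : ∀ B ∈ 𝓑, IsClosed B
  convex : ∀ B ∈ 𝓑, IsGeodesicallyConvex B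
  cover : ⋃₀ 𝓑 = univ

/-- The walls: the non-empty intersections of two distinct blocks. -/
def walls (𝓑 : Set (Set X)) : Set (Set X) :=
  {W | W.Nonempty ∧ ∃ B₁ ∈ 𝓑, ∃ B₂ ∈ 𝓑, B₁ ≠ B₂ ∧ W = B₁ ∩ B₂}

/-- The adjacency graph: the vertices are the blocks, and distinct blocks are adjacent if they
intersect. -/
def adjacencyGraph (𝓑 : Set (Set X)) : SimpleGraph 𝓑 where
  Adj B₁ B₂ := B₁ ≠ B₂ ∧ ((B₁ : Set X) ∩ B₂).Nonempty
  symm := ⟨fun _ _ h => ⟨h.1.symm, by rw [inter_comm]; exact h.2⟩⟩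
  loopless := ⟨fun _ h => h.1 rfl⟩

/-- Treelike block decompositions: the adjacency graph is a tree, and the distance (the infimum of
the distances of points) of distinct walls is bounded below by a positive constant. -/
structure IsTreelike (𝓑 : Set (Set X)) : Prop extends IsBlockDecomposition 𝓑 where
  tree : (adjacencyGraph 𝓑).IsTree
  separating : ∃ d : ℝ, 0 < d ∧ ∀ W₁ ∈ walls 𝓑, ∀ W₂ ∈ walls 𝓑, W₁ ≠ W₂ →
    ∀ x ∈ W₁, ∀ y ∈ W₂, d ≤ dist x y

/-- The part of a block `B` that does not lie in a wall contained in `B`. -/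
def openBlock (𝓑 : Set (Set X)) (B : Set X) : Set X :=
  B \ ⋃₀ {W | W ∈ walls 𝓑 ∧ W ⊆ B}

end Basic

/-! ### Geodesic rays and itineraries -/

/-- A geodesic ray: an isometric embedding of `[0, ∞)`. -/
structure GeodesicRay (X : Type u) [MetricSpace X] where
  toFun : ℝ≥0 → X
  isometry : Isometry toFun

instance (X : Type u) [MetricSpace X] : CoeFun (GeodesicRay X) (fun _ => ℝ≥0 → X) :=
  ⟨GeodesicRay.toFun⟩

section Itinerary

variable {X : Type u} [MetricSpace X]

/-- Finite and (one-sided) infinite paths in the adjacency graph. -/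
inductive BlockPath (𝓑 : Set (Set X)) : Type u
  | finite {B B' : 𝓑} (P : (adjacencyGraph 𝓑).Walk B B') : BlockPath 𝓑
  | infinite (b : ℕ → 𝓑) (hb : ∀ i, (adjacencyGraph 𝓑).Adj (b i) (b (i + 1))) : BlockPath 𝓑

/-- The walls that occur in a path: the edge `{B, B'}` of the adjacency graph is identified with
the wall `B ∩ B'`. -/
def BlockPath.occurringWalls {𝓑 : Set (Set X)} : BlockPath 𝓑 → Set (Set X)
  | .finite P => {W | ∃ B B' : 𝓑, s(B, B') ∈ P.edges ∧ W = (B : Set X) ∩ B'}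
  | .infinite b _ => {W | ∃ i, W = (b i : Set X) ∩ b (i + 1)}

/-- The initial subpath `(b 0, …, b n)` of an infinite path. -/
def initialWalk {𝓑 : Set (Set X)} (b : ℕ → 𝓑)
    (hb : ∀ i, (adjacencyGraph 𝓑).Adj (b i) (b (i + 1))) :
    (n : ℕ) → (adjacencyGraph 𝓑).Walk (b 0) (b n)
  | 0 => .nil
  | n + 1 => (initialWalk b hb n).concat (hb n)

/-- `P` is the itinerary of the geodesic segment from `x` to `y`, where `x` is not in a wall: the
shortest geodesic path linking the block containing `x` with a block containing `y`. -/
def IsSegmentItinerary {𝓑 : Set (Set X)} (x y : X) {B B' : 𝓑}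
    (P : (adjacencyGraph 𝓑).Walk B B') : Prop :=
  x ∈ (B : Set X) ∧ y ∈ (B' : Set X) ∧ P.IsPath ∧
    ∀ (B'' : 𝓑) (Q : (adjacencyGraph 𝓑).Walk B B''), y ∈ (B'' : Set X) → P.length ≤ Q.length

/-- The geodesic ray `γ` eventually stays in one block. -/
def EndsInBlock (𝓑 : Set (Set X)) (γ : GeodesicRay X) : Prop :=
  ∃ B ∈ 𝓑, ∃ t₀ : ℝ≥0, ∀ t ≥ t₀, γ t ∈ B

/-- `I` is the itinerary of the geodesic ray `γ`, where `γ 0` is not in a wall. If `γ` eventually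
stays in one block, it is the itinerary of `γ` restricted to `[0, t]` for all sufficiently large
`t`. Otherwise it is the infinite path `(b 0, b 1, …)` all of whose initial subpaths
`(b 0, …, b i)` are itineraries of `γ` restricted to `[0, t i]`, for times `0 < t 0 < t 1 < …` at
which `γ` is in the block `b i` and not in a wall of it. -/
def IsItinerary {𝓑 : Set (Set X)} (γ : GeodesicRay X) : BlockPath 𝓑 → Prop
  | .finite P => EndsInBlock 𝓑 γ ∧ ∃ t₀ : ℝ≥0, ∀ t ≥ t₀, IsSegmentItinerary (γ 0) (γ t) P
  | .infinite b hb => ¬ EndsInBlock 𝓑 γ ∧ ∃ t : ℕ → ℝ≥0, 0 < t 0 ∧ StrictMono t ∧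
      ∀ i, IsSegmentItinerary (γ 0) (γ (t i)) (initialWalk b hb i) ∧
        γ (t i) ∈ openBlock 𝓑 (b i)

end Itinerary

/-! ### The visual boundary -/

section Boundary

variable (X : Type u) [MetricSpace X]

/-- Two geodesic rays are asymptotic if their distance is bounded. -/
def asymptoticSetoid : Setoid (GeodesicRay X) where
  r α β := ∃ D : ℝ, 0 < D ∧ ∀ t, dist (α t) (β t) < D
  iseqv :=
    { refl := fun _ => ⟨1, one_pos, fun _ => by simp⟩
      symm := fun ⟨D, hD, h⟩ => ⟨D, hD, fun t => by rw [dist_comm]; exact h t⟩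
      trans := fun ⟨D, hD, h⟩ ⟨E, hE, k⟩ => ⟨D + E, add_pos hD hE, fun t =>
        (dist_triangle _ _ _).trans_lt (add_lt_add (h t) (k t))⟩ }

/-- The set of boundary points: asymptotic classes of geodesic rays. -/
def BoundaryPoint : Type u := Quotient (asymptoticSetoid X)

variable {X}

/-- The boundary point represented by `γ`. -/
def GeodesicRay.endpoint (γ : GeodesicRay X) : BoundaryPoint X :=
  Quotient.mk (asymptoticSetoid X) γ

/-- The geodesic rays starting at `p`. -/
def RayFrom (p : X) : Type u := {γ : GeodesicRay X // γ 0 = p}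

/-- The basic neighbourhoods of the cone topology. -/
def coneNhd {p : X} (α : RayFrom p) (r : ℝ≥0) (ε : ℝ) : Set (RayFrom p) :=
  {γ | ∀ t ≤ r, dist (α.1 t) (γ.1 t) < ε}

/-- The cone topology on the set of geodesic rays starting at `p`. -/
instance coneTopology (p : X) : TopologicalSpace (RayFrom p) :=
  TopologicalSpace.generateFrom {U | ∃ (α : RayFrom p) (r : ℝ≥0) (ε : ℝ), 0 < ε ∧ U = coneNhd α r ε}

/-- The visual boundary, topologised with the help of the basepoint `p`. -/
def VisualBoundary (_p : X) : Type u := BoundaryPoint X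

/-- A set of boundary points is open if the set of the geodesic rays from `p` representing its
elements is open in the cone topology. -/
instance visualTopology (p : X) : TopologicalSpace (VisualBoundary p) :=
  TopologicalSpace.coinduced
    (fun γ : RayFrom p => (γ.1.endpoint : BoundaryPoint X)) (coneTopology p)

/-! ### The Morse boundary -/

/-- `σ`, restricted to `[a, b]`, is a `(K, L)`-quasi-geodesic. -/
def IsQuasiGeodesic (K L : ℝ) (a b : ℝ) (σ : ℝ → X) : Prop :=
  ∀ s ∈ Icc a b, ∀ t ∈ Icc a b,
    K⁻¹ * |s - t| - L ≤ dist (σ s) (σ t) ∧ dist (σ s) (σ t) ≤ K * |s - t| + L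

/-- Morse gauges: functions `[1, ∞) × [0, ∞) → [0, ∞)`. -/
def MorseGauge : Type := Ici (1 : ℝ) → Ici (0 : ℝ) → ℝ≥0

/-- `γ` is `M`-Morse: every `(K, L)`-quasi-geodesic with endpoints on `γ` is contained in the
`M (K, L)`-neighbourhood of `γ`. -/
def IsMorseWith (M : MorseGauge) (γ : GeodesicRay X) : Prop :=
  ∀ (K : Ici (1 : ℝ)) (L : Ici (0 : ℝ)) (a b : ℝ) (σ : ℝ → X), a ≤ b →
    IsQuasiGeodesic (K : ℝ) (L : ℝ) a b σ → σ a ∈ range γ → σ b ∈ range γ →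
    ∀ s ∈ Icc a b, ∃ t : ℝ≥0, dist (σ s) (γ t) ≤ M K L

/-- `γ` is Morse. -/
def IsMorse (γ : GeodesicRay X) : Prop := ∃ M : MorseGauge, IsMorseWith M γ

/-- The `M`-Morse geodesic rays starting at `p`. -/
def MorseRayFrom (p : X) (M : MorseGauge) : Type u :=
  {γ : GeodesicRay X // γ 0 = p ∧ IsMorseWith M γ}

/-- The compact-open topology on the set of `M`-Morse geodesic rays starting at `p`. -/
instance (p : X) (M : MorseGauge) : TopologicalSpace (MorseRayFrom p M) :=
  TopologicalSpace.induced
    (fun γ => (⟨γ.1.toFun, γ.1.isometry.continuous⟩ : C(ℝ≥0, X))) inferInstance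

/-- The Morse boundary: the boundary points represented by Morse geodesic rays, topologised with
the help of the basepoint `p`. -/
def MorseBoundary (_p : X) : Type u :=
  {ξ : BoundaryPoint X // ∃ γ : GeodesicRay X, IsMorse γ ∧ γ.endpoint = ξ}

/-- The boundary point represented by an `M`-Morse geodesic ray from `p`. -/
def MorseRayFrom.endpoint {p : X} {M : MorseGauge} (γ : MorseRayFrom p M) : MorseBoundary p :=
  ⟨γ.1.endpoint, γ.1, ⟨M, γ.2.2⟩, rfl⟩

/-- The direct limit topology: a set is open if, for every Morse gauge `M`, the set of the
`M`-Morse geodesic rays from `p` representing its elements is open. -/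
instance morseTopology (p : X) : TopologicalSpace (MorseBoundary p) :=
  ⨆ M : MorseGauge, TopologicalSpace.coinduced
    (fun γ : MorseRayFrom p M => γ.endpoint) inferInstance

end Boundary

/-- `κ` is a connected component of the topological space `Y`. -/
def IsConnectedComponent {Y : Type*} [TopologicalSpace Y] (κ : Set Y) : Prop :=
  ∃ y, κ = connectedComponent y

end Treelike

end

open Set Topology
open scoped NNReal

noncomputable section

namespace Treelike

universe u

/-! ### Geodesics in CAT(0) spaces -/

section CAT0

variable {X : Type u} [MetricSpace X]

/-! Deleting the edge of a wall `W = A ∩ A'` splits the tree into two sides. The unions `half A A'`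
and `half A' A` of their blocks cover the space and meet exactly in `W`. Both are closed and convex
(`isClosed_half`, `half_convex`), so a ray from `p` that leaves the half of `p` never returns, and
`W` occurs in an itinerary exactly when the ray leaves (`mem_occurringWalls_iff`).

The set of rays that leave is open. A connected set of boundary points containing the class of a ray
that leaves and of one that stays therefore contains the class of some `γ` that stays but is a limit
of rays that leave. These cross `W` farther and farther out. Geodesics from a fixed `w ∈ W` to the
crossing points lie in `W`, and by the CAT(0) inequality they converge to a ray in `W` asymptotic to
`γ` (`IsCAT0.exists_ray_in`).

Closedness of a half is delicate, as there may be infinitely many blocks. Separability makes them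
countable, and Sierpiński's theorem together with the gap between walls controls short geodesics.

The Morse boundary maps continuously into the visual boundary, so the same argument applies to the
image of a component. -/

theorem IsGeodesicSegment.dist_left {c : ℝ → X} {x y : X} (hc : IsGeodesicSegment c x y)
    {s : ℝ} (hs : s ∈ Icc 0 (dist x y)) : dist x (c s) = s := by
  have := hc.isom 0 ⟨le_rfl, dist_nonneg⟩ s hs
  rw [hc.left] at this
  rw [this, zero_sub, abs_neg, abs_of_nonneg hs.1]

theorem IsGeodesicSegment.dist_right {c : ℝ → X} {x y : X} (hc : IsGeodesicSegment c x y)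
    {s : ℝ} (hs : s ∈ Icc 0 (dist x y)) : dist (c s) y = dist x y - s := by
  have := hc.isom s hs (dist x y) ⟨dist_nonneg, le_rfl⟩
  rw [hc.right] at this
  rw [this, abs_sub_comm, abs_of_nonneg (sub_nonneg.2 hs.2)]

theorem IsGeodesicSegment.reverse {c : ℝ → X} {x y : X} (hc : IsGeodesicSegment c x y) :
    IsGeodesicSegment (fun s => c (dist x y - s)) y x where
  left := by simpa using hc.right
  right := by simpa [dist_comm y x] using hc.left
  isom s hs t ht := by
    rw [dist_comm y x] at hs ht
    rw [hc.isom _ ⟨by linarith [hs.2], by linarith [hs.1]⟩ _ ⟨by linarith [ht.2], by linarith [ht.1]⟩,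
      abs_sub_comm]
    congr 1
    ring

theorem dist_plane (a b c d : ℝ) :
    dist (!₂[a, b] : EuclideanSpace ℝ (Fin 2)) !₂[c, d] = √((a - c) ^ 2 + (b - d) ^ 2) := by
  simp [EuclideanSpace.dist_eq, Fin.sum_univ_two, Real.dist_eq, sq_abs]

/-- The CAT(0) inequality, with the distance in the comparison triangle computed by the law of
cosines. -/
theorem IsCAT0.dist_sq_le (hX : IsCAT0 X) {x y z : X} {c e : ℝ → X}
    (hc : IsGeodesicSegment c x y) (he : IsGeodesicSegment e x z)
    (hxy : 0 < dist x y) (hxz : 0 < dist x z) {s t : ℝ}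
    (hs : s ∈ Icc 0 (dist x y)) (ht : t ∈ Icc 0 (dist x z)) :
    dist (c s) (e t) ^ 2 ≤ s ^ 2 + t ^ 2 -
      s * t / (dist x y * dist x z) * (dist x y ^ 2 + dist x z ^ 2 - dist y z ^ 2) := by
  have hcomp := fun x' y' z' h₁ h₂ h₃ =>
    hX.comparison x y z c e hc he x' y' z' h₁ h₂ h₃ s hs t ht
  rw [hc.dist_left hs, hc.dist_right hs, he.dist_left ht, he.dist_right ht] at hcomp
  have h1 := dist_triangle x y z
  have h2 := dist_triangle y x z
  have h3 := dist_triangle x z y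
  rw [dist_comm y x] at h2
  rw [dist_comm z y] at h3
  have hl := dist_nonneg (x := y) (y := z)
  generalize dist x y = a at *
  generalize dist x z = b at *
  generalize dist y z = l at *
  -- The comparison triangle is `(0, 0)`, `(a, 0)`, `(u, v)`. The law of cosines gives `u`, and the
  -- triangle inequalities give `u ^ 2 ≤ b ^ 2`, so that `v` exists.
  obtain ⟨u, hu⟩ : ∃ u, u = (a ^ 2 + b ^ 2 - l ^ 2) / (2 * a) := ⟨_, rfl⟩
  have hu' : 2 * a * u = a ^ 2 + b ^ 2 - l ^ 2 := by rw [hu]; field_simp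
  have hub : u ^ 2 ≤ b ^ 2 := by
    apply sq_le_sq'
    · have : 0 ≤ 2 * a * (u + b) := by nlinarith
      have := nonneg_of_mul_nonneg_right this (by positivity)
      linarith
    · have : 0 ≤ 2 * a * (b - u) := by nlinarith
      have := nonneg_of_mul_nonneg_right this (by positivity)
      linarith
  obtain ⟨v, hv⟩ : ∃ v, v = √(b ^ 2 - u ^ 2) := ⟨_, rfl⟩
  have hv2 : v ^ 2 = b ^ 2 - u ^ 2 := by rw [hv]; exact Real.sq_sqrt (by linarith)
  have hsq : ∀ {A B : ℝ}, 0 ≤ B → A = B ^ 2 → √A = B := fun hB h => by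
    rw [h, Real.sqrt_sq hB]
  have key := hcomp !₂[0, 0] !₂[a, 0] !₂[u, v]
    (by rw [dist_plane]; exact hsq hxy.le (by ring))
    (by rw [dist_plane]; exact hsq hl (by linarith))
    (by rw [dist_plane]; exact hsq hxz.le (by linarith))
    !₂[s, 0] !₂[t / b * u, t / b * v]
    (by rw [dist_plane]; exact hsq hs.1 (by ring))
    (by rw [dist_plane]; exact hsq (by linarith [hs.2]) (by ring))
    (by rw [dist_plane]; exact hsq ht.1 (by
          have : t ^ 2 = (t / b) ^ 2 * b ^ 2 := by field_simp
          linear_combination (t / b) ^ 2 * hv2 - this))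
    (by rw [dist_plane]; exact hsq (by linarith [ht.2]) (by
          have : b - t = (1 - t / b) * b := by field_simp
          rw [this]; linear_combination (t / b - 1) ^ 2 * hv2))
  rw [dist_plane] at key
  have := pow_le_pow_left₀ dist_nonneg key 2
  rw [Real.sq_sqrt (by positivity)] at this
  refine this.trans (le_of_eq ?_)
  rw [← hu']
  field_simp
  linear_combination t ^ 2 * hv2

end CAT0

/-! ### Geodesic rays in CAT(0) spaces -/

section Rays

variable {X : Type u} [MetricSpace X]

/-- At equal times the law of cosines collapses to this quotient, which is small when both endpoints
are far from `x` and the numerator grows more slowly than the product of the lengths. -/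
theorem IsCAT0.dist_sq_le_of_eq (hX : IsCAT0 X) {x y z : X} {c e : ℝ → X}
    (hc : IsGeodesicSegment c x y) (he : IsGeodesicSegment e x z)
    (hxy : 0 < dist x y) (hxz : 0 < dist x z) {t : ℝ} (ht₀ : 0 ≤ t)
    (hty : t ≤ dist x y) (htz : t ≤ dist x z) :
    dist (c t) (e t) ^ 2 ≤
      t ^ 2 * ((dist y z ^ 2 - (dist x y - dist x z) ^ 2) / (dist x y * dist x z)) := by
  refine (hX.dist_sq_le hc he hxy hxz ⟨ht₀, hty⟩ ⟨ht₀, htz⟩).trans (le_of_eq ?_)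
  field_simp
  ring

/-- Convexity of the distance of two geodesics issuing from the same point. -/
theorem IsCAT0.dist_le_mul (hX : IsCAT0 X) {x y z : X} {c e : ℝ → X}
    (hc : IsGeodesicSegment c x y) (he : IsGeodesicSegment e x z)
    (hxy : 0 < dist x y) (hxz : 0 < dist x z) {r : ℝ} (hr₀ : 0 ≤ r) (hr₁ : r ≤ 1) :
    dist (c (r * dist x y)) (e (r * dist x z)) ≤ r * dist y z := by
  refine le_of_sq_le_sq ?_ (by positivity)
  refine (hX.dist_sq_le hc he hxy hxz ⟨by positivity, by nlinarith⟩
    ⟨by positivity, by nlinarith⟩).trans (le_of_eq ?_)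
  field_simp
  ring

theorem GeodesicRay.dist_eq (γ : GeodesicRay X) (s t : ℝ≥0) :
    dist (γ s) (γ t) = |(s : ℝ) - t| := by
  rw [γ.isometry.dist_eq, NNReal.dist_eq]

theorem GeodesicRay.dist_eq_of_le (γ : GeodesicRay X) {s t : ℝ≥0} (h : s ≤ t) :
    dist (γ s) (γ t) = t - s := by
  rw [γ.dist_eq, abs_sub_comm, abs_of_nonneg (sub_nonneg.2 (NNReal.coe_le_coe.2 h))]

theorem GeodesicRay.dist_zero (γ : GeodesicRay X) (t : ℝ≥0) : dist (γ 0) (γ t) = t := by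
  rw [γ.dist_eq_of_le zero_le]; simp

theorem GeodesicRay.isGeodesicSegment (γ : GeodesicRay X) {a b : ℝ≥0} (h : a ≤ b) :
    IsGeodesicSegment (fun s => γ (a + s.toNNReal)) (γ a) (γ b) := by
  have hd := γ.dist_eq_of_le h
  refine ⟨by simp, ?_, ?_⟩
  · rw [hd]
    congr 1
    rw [← NNReal.coe_sub h, Real.toNNReal_coe, add_tsub_cancel_of_le h]
  · intro s hs t ht
    rw [γ.dist_eq]
    push_cast
    rw [Real.coe_toNNReal _ hs.1, Real.coe_toNNReal _ ht.1]
    congr 1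
    ring

theorem tendsto_const_div_natCast_sub (C D : ℝ) :
    Filter.Tendsto (fun n : ℕ => C / ((n : ℝ) - D)) Filter.atTop (𝓝 0) :=
  Filter.Tendsto.div_atTop tendsto_const_nhds
    (Filter.tendsto_atTop_add_const_right _ _ tendsto_natCast_atTop_atTop)

/-- Asymptotic geodesic rays with the same starting point are equal. -/
theorem IsCAT0.eq_of_endpoint_eq (hX : IsCAT0 X) {γ γ' : GeodesicRay X} (h₀ : γ 0 = γ' 0)
    (h : γ.endpoint = γ'.endpoint) : γ = γ' := by
  obtain ⟨D, hD, hb⟩ := Quotient.exact h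
  suffices H : ∀ t, γ t = γ' t by
    cases γ; cases γ'
    congr
    exact funext H
  intro t
  -- The rays are less than `D` apart at time `n`, so by convexity at most `t * D / n` apart at time
  -- `t`.
  have hlim := tendsto_const_div_natCast_sub ((t : ℝ) * D) 0
  have : dist (γ t) (γ' t) ≤ 0 := by
    refine ge_of_tendsto hlim ?_
    filter_upwards [Filter.eventually_ge_atTop (⌈(t : ℝ)⌉₊ + 1)] with n hn
    have hn' : (t : ℝ) ≤ n :=
      (Nat.le_ceil _).trans (by exact_mod_cast (Nat.le_succ _).trans hn)
    have hn0 : (0 : ℝ) < n := by exact_mod_cast (Nat.succ_pos _).trans_le hn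
    have h1 := γ.isGeodesicSegment (a := 0) (b := n) zero_le
    have h2 := γ'.isGeodesicSegment (a := 0) (b := n) zero_le
    rw [← h₀] at h2
    have d1 : dist (γ 0) (γ n) = n := γ.dist_zero n
    have d2 : dist (γ 0) (γ' n) = n := h₀ ▸ γ'.dist_zero n
    have key := hX.dist_le_mul h1 h2 (by rwa [d1]) (by rwa [d2]) (r := t / n) (by positivity)
      ((div_le_one hn0).2 hn')
    rw [d1, d2, div_mul_cancel₀ _ hn0.ne', Real.toNNReal_coe, zero_add] at key
    refine key.trans ?_
    rw [sub_zero, div_mul_eq_mul_div]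
    have := (hb n).le
    gcongr
  exact dist_le_zero.1 this

/-- Geodesics from `w` to two far points of a geodesic ray are close. -/
theorem IsCAT0.dist_sq_le_of_ray (hX : IsCAT0 X) (γ : GeodesicRay X) {w : X} {r s : ℝ≥0}
    (hrs : r ≤ s) {c e : ℝ → X} (hc : IsGeodesicSegment c w (γ r))
    (he : IsGeodesicSegment e w (γ s)) {t : ℝ} (ht₀ : 0 ≤ t)
    (hr : dist w (γ 0) < r) (ht : t ≤ r - dist w (γ 0)) :
    dist (c t) (e t) ^ 2 ≤ t ^ 2 * (4 * dist w (γ 0) / (r - dist w (γ 0))) := by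
  have hd := γ.dist_eq_of_le hrs
  have hr0 := γ.dist_zero r
  have hs0 := γ.dist_zero s
  have hrs' : (r : ℝ) ≤ s := hrs
  have t1 := dist_triangle (γ 0) w (γ r)
  have t2 := dist_triangle (γ 0) w (γ s)
  have t3 := dist_triangle w (γ 0) (γ r)
  have t4 := dist_triangle w (γ r) (γ s)
  have t5 := dist_triangle w (γ s) (γ r)
  rw [dist_comm (γ 0) w] at t1 t2
  rw [dist_comm (γ s)] at t5
  have hD := dist_nonneg (x := w) (y := γ 0)
  have ha : 0 < dist w (γ r) := by linarith
  have hb : 0 < dist w (γ s) := by linarith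
  refine (hX.dist_sq_le_of_eq hc he ha hb ht₀ (by linarith) (by linarith)).trans ?_
  refine mul_le_mul_of_nonneg_left ?_ (sq_nonneg t)
  rw [hd] at *
  rw [hr0] at *
  rw [hs0] at *
  generalize dist w (γ 0) = D at *
  generalize dist w (γ r) = a at *
  generalize dist w (γ s) = b at *
  have hrD : 0 < (r : ℝ) - D := by linarith
  rw [div_le_div_iff₀ (by positivity) hrD]
  -- The factors are at most `2 * D` and `2 * (s - r)`. The factor `s - r` cancels against `h2`, so
  -- the final bound does not depend on `s`.
  have h1 : ((s : ℝ) - r) ^ 2 - (a - b) ^ 2 ≤ 2 * D * (2 * (s - r)) := by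
    have : ((s : ℝ) - r) ^ 2 - (a - b) ^ 2 = (s - r - (b - a)) * (s - r + (b - a)) := by ring
    rw [this]
    apply mul_le_mul <;> linarith
  have h2 : ((s : ℝ) - r) * (r - D) ≤ b * a := by
    apply mul_le_mul <;> linarith
  calc _ ≤ 2 * D * (2 * (s - r)) * (r - D) := mul_le_mul_of_nonneg_right h1 hrD.le
    _ = 4 * D * ((s - r) * (r - D)) := by ring
    _ ≤ 4 * D * (b * a) := mul_le_mul_of_nonneg_left h2 (by positivity)
    _ = _ := by ring

/-- Seen from `γ r`, proportional points of the two geodesics are at most `dist w (γ 0)` apart.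
Passing from proportional to equal times costs at most the same amount again, since the lengths
differ by no more. -/
theorem IsCAT0.dist_ray_le (hX : IsCAT0 X) (γ : GeodesicRay X) {w : X} {r t : ℝ≥0}
    {c : ℝ → X} (hc : IsGeodesicSegment c w (γ r)) (hr : dist w (γ 0) < r)
    (ht : t ≤ r - dist w (γ 0)) : dist (c t) (γ t) ≤ 2 * dist w (γ 0) := by
  have hD := dist_nonneg (x := w) (y := γ 0)
  have h1 := hc.reverse
  have h2 := (γ.isGeodesicSegment (a := 0) (b := r) zero_le).reverse
  have hr0 := γ.dist_zero r
  have t1 := dist_triangle (γ 0) w (γ r)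
  have t3 := dist_triangle w (γ 0) (γ r)
  rw [dist_comm (γ 0) w] at t1
  have ha : 0 < dist w (γ r) := by linarith
  have hta : (t : ℝ) ≤ dist w (γ r) := by linarith
  have hr' : (0 : ℝ) < r := by linarith
  have key := hX.dist_le_mul h1 h2 (by rwa [dist_comm]) (by rwa [dist_comm, hr0])
    (r := (dist w (γ r) - t) / dist w (γ r)) (div_nonneg (by linarith) ha.le)
    ((div_le_one ha).2 (by linarith [t.coe_nonneg]))
  simp only [dist_comm (γ r) w, dist_comm (γ r) (γ 0), hr0] at key
  rw [div_mul_cancel₀ _ ha.ne', sub_sub_cancel, zero_add] at key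
  have e1 : (r : ℝ) - (dist w (γ r) - t) / dist w (γ r) * r = r * t / dist w (γ r) := by
    field_simp
    ring
  rw [e1] at key
  have e2 : dist (γ (r * t / dist w (γ r)).toNNReal) (γ t) ≤ dist w (γ 0) := by
    rw [γ.dist_eq, Real.coe_toNNReal _ (by positivity)]
    have : r * t / dist w (γ r) - t = (r - dist w (γ r)) * (t / dist w (γ r)) := by
      field_simp
    rw [this, abs_mul, abs_of_nonneg (div_nonneg t.coe_nonneg ha.le)]
    have h3 : |(r : ℝ) - dist w (γ r)| ≤ dist w (γ 0) := abs_le.2 ⟨by linarith, by linarith⟩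
    have h4 : (t : ℝ) / dist w (γ r) ≤ 1 := (div_le_one ha).2 hta
    calc _ ≤ dist w (γ 0) * 1 := mul_le_mul h3 h4 (div_nonneg t.coe_nonneg ha.le) hD
      _ = _ := mul_one _
  have h5 : (dist w (γ r) - t) / dist w (γ r) ≤ 1 := (div_le_one ha).2 (by linarith [t.coe_nonneg])
  have h6 := mul_le_mul_of_nonneg_right h5 hD
  have := dist_triangle (c t) (γ (r * t / dist w (γ r)).toNNReal) (γ t)
  linarith

theorem exists_forall_ge_mem_of_tendsto {u : ℕ → ℝ} (hu : Filter.Tendsto u Filter.atTop (𝓝 0))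
    {ε : ℝ} (hε : 0 < ε) : ∃ N, ∀ n ≥ N, u n < ε :=
  Filter.eventually_atTop.1 (hu.eventually (gt_mem_nhds hε))

/-- If a geodesic ray `γ` is approximated by geodesic rays that meet a closed convex set far out,
then it is asymptotic to a geodesic ray in this set. -/
theorem IsCAT0.exists_ray_in [CompleteSpace X] (hX : IsCAT0 X) (γ : GeodesicRay X) {W : Set X}
    (hW : IsClosed W) (hconv : IsGeodesicallyConvex W)
    (h : ∀ R : ℝ≥0, ∃ γ' : GeodesicRay X, γ' 0 = γ 0 ∧ dist (γ R) (γ' R) ≤ 1 ∧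
      ∃ s ≥ R, γ' s ∈ W) :
    ∃ ρ : GeodesicRay X, range ρ ⊆ W ∧ ρ.endpoint = γ.endpoint := by
  obtain ⟨w, hw⟩ : W.Nonempty := by
    obtain ⟨γ', _, _, s, _, hs⟩ := h 0
    exact ⟨_, hs⟩
  choose γ' h₀ h₁ s hs hsW using fun n : ℕ => h n
  -- `c n` aims at `γ`, `e n` runs inside `W`, and `f n` mediates: its endpoint is within `1` of
  -- that of `c n` and lies on the same ray `γ' n` as that of `e n`. The common limit inherits
  -- isometry and asymptoticity from `c n` and containment in `W` from `e n`.
  choose c hc using fun n : ℕ => hX.geodesic w (γ n)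
  choose f hf using fun n : ℕ => hX.geodesic w (γ' n n)
  choose e he using fun n : ℕ => hX.geodesic w (γ' n (s n))
  have hD := dist_nonneg (x := w) (y := γ 0)
  obtain ⟨D, hDdef⟩ : ∃ D, D = dist w (γ 0) := ⟨_, rfl⟩
  have hlen : ∀ n : ℕ, (n : ℝ) - D ≤ dist w (γ n) := fun n => by
    have h1 : dist (γ 0) (γ n) = n := γ.dist_zero n
    have := dist_triangle (γ 0) w (γ n)
    rw [dist_comm (γ 0) w] at this
    linarith
  have hlen' : ∀ (n : ℕ) (r : ℝ≥0), (r : ℝ) - D ≤ dist w (γ' n r) := fun n r => by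
    have h1 := (γ' n).dist_zero r
    rw [h₀] at h1
    have := dist_triangle (γ 0) w (γ' n r)
    rw [dist_comm (γ 0) w] at this
    linarith
  -- The `+ 1` ensures `1 ≤ n - D`, whence `n - D ≤ (n - D) ^ 2` in `hcf`.
  have hlarge : ∀ t : ℝ≥0, ∃ N : ℕ, ∀ n ≥ N, (t : ℝ) + 1 ≤ n - D := fun t => by
    obtain ⟨N, hN⟩ := exists_nat_ge ((t : ℝ) + 1 + D)
    refine ⟨N, fun n hn => ?_⟩
    have : (N : ℝ) ≤ n := by exact_mod_cast hn
    linarith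
  have hcc : ∀ (t : ℝ≥0) (n m : ℕ), n ≤ m → (t : ℝ) + 1 ≤ n - D →
      dist (c n t) (c m t) ^ 2 ≤ t ^ 2 * (4 * D) / (n - D) := fun t n m hnm hn => by
    have := hX.dist_sq_le_of_ray γ (r := n) (s := m) (by exact_mod_cast hnm) (hc n) (hc m) t.coe_nonneg
      (by rw [← hDdef]; push_cast; linarith [t.coe_nonneg]) (by rw [← hDdef]; push_cast; linarith)
    rw [← hDdef, ← mul_div_assoc] at this
    exact_mod_cast this
  have hef : ∀ (t : ℝ≥0) (n : ℕ), (t : ℝ) + 1 ≤ n - D →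
      dist (f n t) (e n t) ^ 2 ≤ t ^ 2 * (4 * D) / (n - D) := fun t n hn => by
    have := hX.dist_sq_le_of_ray (γ' n) (r := n) (s := s n) (hs n) (hf n) (he n) t.coe_nonneg
      (by rw [h₀, ← hDdef]; push_cast; linarith [t.coe_nonneg]) (by rw [h₀, ← hDdef]; push_cast; linarith)
    rw [h₀, ← hDdef, ← mul_div_assoc] at this
    exact_mod_cast this
  have hcf : ∀ (t : ℝ≥0) (n : ℕ), (t : ℝ) + 1 ≤ n - D →
      dist (c n t) (f n t) ^ 2 ≤ t ^ 2 / (n - D) := fun t n hn => by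
    have ht := t.coe_nonneg
    have ha := hlen n
    have hb := hlen' n n
    push_cast at hb
    have hpos : (1 : ℝ) ≤ n - D := by linarith [t.coe_nonneg]
    have := hX.dist_sq_le_of_eq (hc n) (hf n) (by linarith) (by linarith) t.coe_nonneg
      (by linarith) (by linarith)
    refine this.trans ?_
    rw [div_eq_mul_inv ((t : ℝ) ^ 2), ← one_div]
    refine mul_le_mul_of_nonneg_left ?_ (sq_nonneg _)
    refine div_le_div₀ zero_le_one ?_ (by linarith) ?_
    · have h2 := h₁ n
      nlinarith [dist_nonneg (x := γ n) (y := γ' n n),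
        sq_nonneg (dist w (γ n) - dist w (γ' n n))]
    · nlinarith
  have hsmall : ∀ (C : ℝ) {ε : ℝ}, 0 < ε → ∃ N : ℕ, ∀ n ≥ N, C / ((n : ℝ) - D) < ε ^ 2 :=
    fun C ε hε => exists_forall_ge_mem_of_tendsto (tendsto_const_div_natCast_sub C D)
      (by positivity)
  have hcauchy : ∀ t : ℝ≥0, CauchySeq fun n => c n t := fun t => by
    rw [Metric.cauchySeq_iff']
    intro ε hε
    obtain ⟨N₁, hN₁⟩ := hlarge t
    obtain ⟨N₂, hN₂⟩ := hsmall (t ^ 2 * (4 * D)) hε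
    refine ⟨max N₁ N₂, fun n hn => ?_⟩
    rw [dist_comm]
    refine lt_of_pow_lt_pow_left₀ 2 hε.le ?_
    exact (hcc t _ n hn (hN₁ _ (le_max_left _ _))).trans_lt (hN₂ _ (le_max_right _ _))
  choose ρ hρ using fun t => cauchySeq_tendsto_of_complete (hcauchy t)
  have hρe : ∀ t : ℝ≥0, Filter.Tendsto (fun n => e n t) Filter.atTop (𝓝 (ρ t)) := fun t => by
    refine (tendsto_iff_of_dist (f₁ := fun n => c n t) ?_).1 (hρ t)
    rw [Metric.tendsto_atTop]
    intro ε hε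
    obtain ⟨N₁, hN₁⟩ := hlarge t
    obtain ⟨N₂, hN₂⟩ := hsmall (t ^ 2 * (4 * D)) (half_pos hε)
    obtain ⟨N₃, hN₃⟩ := hsmall (t ^ 2) (half_pos hε)
    refine ⟨max N₁ (max N₂ N₃), fun n hn => ?_⟩
    have g1 := hN₁ n ((le_max_left _ _).trans hn)
    have g2 := hN₂ n (((le_max_left _ _).trans (le_max_right _ _)).trans hn)
    have g3 := hN₃ n (((le_max_right _ _).trans (le_max_right _ _)).trans hn)
    have k1 := lt_of_pow_lt_pow_left₀ 2 (half_pos hε).le ((hcf t n g1).trans_lt g3)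
    have k2 := lt_of_pow_lt_pow_left₀ 2 (half_pos hε).le ((hef t n g1).trans_lt g2)
    rw [Real.dist_0_eq_abs, abs_of_nonneg dist_nonneg]
    linarith [dist_triangle (c n t) (f n t) (e n t)]
  refine ⟨⟨ρ, Isometry.of_dist_eq fun t t' => ?_⟩, ?_, ?_⟩
  · refine tendsto_nhds_unique ((hρ t).dist (hρ t')) (tendsto_const_nhds.congr' ?_)
    obtain ⟨N₁, hN₁⟩ := hlarge t
    obtain ⟨N₂, hN₂⟩ := hlarge t'
    filter_upwards [Filter.eventually_ge_atTop (max N₁ N₂)] with n hn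
    have g1 := hN₁ n ((le_max_left _ _).trans hn)
    have g2 := hN₂ n ((le_max_right _ _).trans hn)
    rw [NNReal.dist_eq, (hc n).isom _ ⟨t.coe_nonneg, by linarith [hlen n]⟩ _ ⟨t'.coe_nonneg, by linarith [hlen n]⟩]
  · rintro _ ⟨t, rfl⟩
    refine hW.mem_of_tendsto (hρe t) ?_
    obtain ⟨N₁, hN₁⟩ := hlarge t
    filter_upwards [Filter.eventually_ge_atTop N₁] with n hn
    have g1 := hN₁ n hn
    have g2 : (n : ℝ) ≤ s n := by exact_mod_cast hs n
    exact hconv w hw _ (hsW n) _ (he n) _ ⟨t.coe_nonneg, by linarith [hlen' n (s n)]⟩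
  · refine Quotient.sound ⟨2 * D + 1, by linarith, fun t => ?_⟩
    have : dist (ρ t) (γ t) ≤ 2 * D := by
      refine le_of_tendsto ((hρ t).dist tendsto_const_nhds) ?_
      obtain ⟨N₁, hN₁⟩ := hlarge t
      filter_upwards [Filter.eventually_ge_atTop N₁] with n hn
      have g1 := hN₁ n hn
      rw [hDdef] at g1 ⊢
      exact hX.dist_ray_le γ (hc n) (by push_cast; linarith [t.coe_nonneg]) (by push_cast; linarith)
    exact this.trans_lt (by linarith)

end Rays

/-! ### Countable closed partitions of the line -/

/-- Sierpiński's theorem for the real line: it is not the union of countably many disjoint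
non-empty closed sets, except in the trivial way. -/
theorem eq_of_isClosed_fiber {ι : Type*} [Countable ι] (g : ℝ → ι)
    (hg : ∀ i, IsClosed (g ⁻¹' {i})) (s t : ℝ) : g s = g t := by
  -- `E` is the set of points where `g` is not locally constant. If it is non-empty, Baire's theorem
  -- in `E` gives a ball around some `e ∈ E` on which `g` equals `i` at all points of `E`.
  let E : Set ℝ := (⋃ i, interior (g ⁻¹' {i}))ᶜ
  have hE : ∀ x ∉ E, x ∈ interior (g ⁻¹' {g x}) := by
    intro x hx
    obtain ⟨i, hi⟩ := mem_iUnion.1 (notMem_compl_iff.1 hx)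
    have : x ∈ g ⁻¹' {i} := interior_subset hi
    rw [mem_preimage, mem_singleton_iff] at this
    rwa [this]
  by_cases hne : E.Nonempty
  · exfalso
    have hEc : IsClosed E := (isOpen_iUnion fun i => isOpen_interior).isClosed_compl
    have : CompleteSpace E := hEc.completeSpace_coe
    have : Nonempty E := hne.to_subtype
    obtain ⟨i, e, he⟩ := nonempty_interior_of_iUnion_of_closed
      (f := fun i => ((↑) : E → ℝ) ⁻¹' (g ⁻¹' {i})) (fun i => (hg i).preimage continuous_subtype_val)
      (eq_univ_of_forall fun e => mem_iUnion.2 ⟨g e, rfl⟩)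
    obtain ⟨ε, hε, hball⟩ := Metric.isOpen_iff.1 isOpen_interior e he
    have hball' : ∀ x ∈ Metric.ball (e : ℝ) ε, x ∈ E → g x = i := fun x hx hxE => by
      have : (⟨x, hxE⟩ : E) ∈ ((↑) : E → ℝ) ⁻¹' (g ⁻¹' {i}) := interior_subset (hball (show (⟨x, hxE⟩ : E) ∈ Metric.ball e ε from hx))
      exact this
    have hei : g e = i := hball' e (Metric.mem_ball_self hε) e.2
    -- A fibre of another value misses `E` in the ball, so it is both open and closed there,
    -- contradicting connectedness.
    have hconst : ∀ y ∈ Metric.ball (e : ℝ) ε, g y = i := by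
      intro y hy
      by_contra hyi
      have hpre : IsPreconnected (Metric.ball (e : ℝ) ε) := (convex_ball _ _).isPreconnected
      have hcover : Metric.ball (e : ℝ) ε ⊆
          interior (g ⁻¹' {g y}) ∪ (g ⁻¹' {g y})ᶜ := by
        intro z hz
        by_cases hzy : g z = g y
        · left
          rw [← hzy]
          refine hE z fun hzE => hyi ?_
          rw [← hzy, hball' z hz hzE]
        · exact Or.inr hzy
      have hdisj : Disjoint (interior (g ⁻¹' {g y})) (g ⁻¹' {g y})ᶜ :=
        disjoint_compl_right.mono_left interior_subset
      rcases hpre.subset_or_subset isOpen_interior (hg _).isOpen_compl hdisj hcover with h | h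
      · have : (e : ℝ) ∈ g ⁻¹' {g y} := interior_subset (h (Metric.mem_ball_self hε))
        exact hyi (Eq.trans (Eq.symm this) hei)
      · exact h hy rfl
    refine e.2 (mem_iUnion.2 ⟨i, mem_interior.2 ⟨_, fun y hy => hconst y hy, Metric.isOpen_ball,
      Metric.mem_ball_self hε⟩⟩)
  · rw [not_nonempty_iff_eq_empty] at hne
    have hloc : IsLocallyConstant g := by
      rw [IsLocallyConstant.iff_exists_open]
      intro x
      exact ⟨_, isOpen_interior, hE x (by simp [hne]), fun y hy => mem_singleton_iff.1 (mem_preimage.1 (interior_subset hy))⟩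
    exact hloc.apply_eq_of_isPreconnected isPreconnected_univ (mem_univ _) (mem_univ _)

/-! ### The two sides of a wall -/

section Sides

variable {X : Type u} {𝓑 : Set (Set X)}

/-- The blocks on the same side of the edge `{A, A'}` of the adjacency graph as `A`. -/
def side (A A' : 𝓑) : Set 𝓑 :=
  {C | ((adjacencyGraph 𝓑).deleteEdges {s(A, A')}).Reachable A C}

/-- The union of the blocks on the same side of the edge `{A, A'}` as `A`. -/
def half (A A' : 𝓑) : Set X := {x | ∃ C ∈ side A A', x ∈ (C : Set X)}

theorem left_mem_side (A A' : 𝓑) : A ∈ side A A' := SimpleGraph.Reachable.refl _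

theorem mem_side_of_adj {A A' C D : 𝓑} (hC : C ∈ side A A') (hCD : (adjacencyGraph 𝓑).Adj C D)
    (hne : s(C, D) ≠ s(A, A')) : D ∈ side A A' := by
  refine SimpleGraph.Reachable.trans hC (SimpleGraph.Adj.reachable ?_)
  rw [SimpleGraph.deleteEdges_adj]
  exact ⟨hCD, hne⟩

theorem adj_of_mem {C D : 𝓑} (hne : C ≠ D) {x : X} (hC : x ∈ (C : Set X)) (hD : x ∈ (D : Set X)) :
    (adjacencyGraph 𝓑).Adj C D :=
  ⟨hne, x, hC, hD⟩

theorem edge_mem_walls {C C' : 𝓑} (hC : C ≠ C') {x : X} (hxC : x ∈ (C : Set X))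
    (hxC' : x ∈ (C' : Set X)) : (C ∩ C' : Set X) ∈ walls 𝓑 :=
  ⟨⟨x, hxC, hxC'⟩, C, C.2, C', C'.2, fun h => hC (Subtype.ext h), rfl⟩

theorem subset_half (A A' : 𝓑) : (A : Set X) ⊆ half A A' := fun _ hx => ⟨A, left_mem_side _ _, hx⟩

variable [MetricSpace X]

theorem side_union (h𝓑 : IsTreelike 𝓑) (A A' C : 𝓑) : C ∈ side A A' ∨ C ∈ side A' A := by
  obtain ⟨p⟩ := h𝓑.tree.connected.preconnected C A
  suffices H : ∀ {C D : 𝓑} (_ : (adjacencyGraph 𝓑).Walk C D), D = A →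
      C ∈ side A A' ∨ C ∈ side A' A from H p rfl
  intro C D p hD
  induction p with
  | nil => exact Or.inl (hD ▸ left_mem_side A A')
  | @cons u v w huv _ ih =>
    by_cases he : s(v, u) = s(A, A')
    · rcases Sym2.eq_iff.1 he with ⟨-, rfl⟩ | ⟨-, rfl⟩
      · exact Or.inr (left_mem_side _ _)
      · exact Or.inl (left_mem_side _ _)
    · rcases ih hD with h | h
      · exact Or.inl (mem_side_of_adj h huv.symm he)
      · exact Or.inr (mem_side_of_adj h huv.symm (by rwa [Sym2.eq_swap (a := A')]))

/-- Every edge of an acyclic graph is a bridge. -/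
theorem side_disjoint (h𝓑 : IsTreelike 𝓑) {A A' : 𝓑} (hA : (adjacencyGraph 𝓑).Adj A A') {C : 𝓑}
    (h : C ∈ side A A') (h' : C ∈ side A' A) : False := by
  have hb := SimpleGraph.isAcyclic_iff_forall_adj_isBridge.1 h𝓑.tree.isAcyclic hA
  rw [SimpleGraph.isBridge_iff] at hb
  have h'' : ((adjacencyGraph 𝓑).deleteEdges {s(A, A')}).Reachable A' C := by
    rw [Sym2.eq_swap]
    exact h'
  exact hb (SimpleGraph.Reachable.trans h h''.symm)

theorem edge_eq_of_adj (h𝓑 : IsTreelike 𝓑) {A A' : 𝓑} (hA : (adjacencyGraph 𝓑).Adj A A') {C D : 𝓑}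
    (hC : C ∈ side A A') (hD : D ∈ side A' A) (hCD : (adjacencyGraph 𝓑).Adj C D) :
    C = A ∧ D = A' := by
  by_cases he : s(C, D) = s(A, A')
  · rcases Sym2.eq_iff.1 he with h | ⟨rfl, rfl⟩
    · exact h
    · exact (side_disjoint h𝓑 hA (left_mem_side _ _) hD).elim
  · exact (side_disjoint h𝓑 hA (mem_side_of_adj hC hCD he) hD).elim

theorem edge_eq_of_mem (h𝓑 : IsTreelike 𝓑) {A A' : 𝓑} (hA : (adjacencyGraph 𝓑).Adj A A') {C D : 𝓑}
    (hC : C ∈ side A A') (hD : D ∈ side A' A) {x : X} (hxC : x ∈ (C : Set X))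
    (hxD : x ∈ (D : Set X)) : C = A ∧ D = A' :=
  edge_eq_of_adj h𝓑 hA hC hD
    (adj_of_mem (fun h => side_disjoint h𝓑 hA hC (h ▸ hD)) hxC hxD)

theorem eq_or_eq_of_mem_wall (h𝓑 : IsTreelike 𝓑) {A A' : 𝓑} (hne : A ≠ A')
    {x : X} (hxA : x ∈ (A : Set X)) (hxA' : x ∈ (A' : Set X)) {C : 𝓑} (hxC : x ∈ (C : Set X)) :
    C = A ∨ C = A' := by
  have hA := adj_of_mem hne hxA hxA'
  rcases side_union h𝓑 A A' C with h | h
  · exact Or.inl (edge_eq_of_mem h𝓑 hA h (left_mem_side _ _) hxC hxA').1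
  · exact Or.inr (edge_eq_of_mem h𝓑 hA (left_mem_side _ _) h hxA hxC).2

/-- Blocks have no triple intersections: a wall determines its edge. -/
theorem edge_eq_of_mem_wall (h𝓑 : IsTreelike 𝓑) {A A' C C' : 𝓑} (hA : A ≠ A') (hC : C ≠ C') {x : X}
    (hxA : x ∈ (A : Set X)) (hxA' : x ∈ (A' : Set X)) (hxC : x ∈ (C : Set X))
    (hxC' : x ∈ (C' : Set X)) : s(C, C') = s(A, A') := by
  rw [Sym2.eq_iff]
  rcases eq_or_eq_of_mem_wall h𝓑 hA hxA hxA' hxC with rfl | rfl <;>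
    rcases eq_or_eq_of_mem_wall h𝓑 hA hxA hxA' hxC' with rfl | rfl <;> simp_all

theorem exists_block (h𝓑 : IsTreelike 𝓑) (x : X) : ∃ C : 𝓑, x ∈ (C : Set X) := by
  have := h𝓑.cover
  obtain ⟨C, hC, hx⟩ := (this ▸ mem_univ x : x ∈ ⋃₀ 𝓑)
  exact ⟨⟨C, hC⟩, hx⟩

theorem half_union (h𝓑 : IsTreelike 𝓑) (A A' : 𝓑) (x : X) : x ∈ half A A' ∨ x ∈ half A' A := by
  obtain ⟨C, hC⟩ := exists_block h𝓑 x
  exact (side_union h𝓑 A A' C).imp (fun h => ⟨C, h, hC⟩) (fun h => ⟨C, h, hC⟩)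

theorem mem_wall_of_mem_half (h𝓑 : IsTreelike 𝓑) {A A' : 𝓑} (hA : (adjacencyGraph 𝓑).Adj A A')
    {x : X} (h : x ∈ half A A') (h' : x ∈ half A' A) : x ∈ (A ∩ A' : Set X) := by
  obtain ⟨C, hC, hxC⟩ := h
  obtain ⟨D, hD, hxD⟩ := h'
  obtain ⟨rfl, rfl⟩ := edge_eq_of_mem h𝓑 hA hC hD hxC hxD
  exact ⟨hxC, hxD⟩

/-! ### Countability -/

/-- Balls of radius `d / 2` about one point of each wall are disjoint, so there are countably many
walls. Each lies in at most two blocks, and every block contains one unless there is at most one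
block. -/
theorem IsTreelike.countable [TopologicalSpace.SeparableSpace X] (h𝓑 : IsTreelike 𝓑) :
    Countable 𝓑 := by
  obtain ⟨d, hd, hsep⟩ := h𝓑.separating
  have hw : (walls 𝓑).Countable := by
    by_cases hX : IsEmpty X
    · exact Set.to_countable _
    rw [not_isEmpty_iff] at hX
    choose! c hc using fun (W : Set X) (hW : W ∈ walls 𝓑) => hW.1
    refine Set.PairwiseDisjoint.countable_of_isOpen (s := fun W => Metric.ball (c W) (d / 2))
      (fun W₁ h₁ W₂ h₂ hne => ?_) (fun _ _ => Metric.isOpen_ball)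
      (fun W _ => ⟨c W, Metric.mem_ball_self (half_pos hd)⟩)
    refine Metric.ball_disjoint_ball ?_
    linarith [hsep W₁ h₁ W₂ h₂ hne _ (hc _ h₁) _ (hc _ h₂)]
  by_cases hs : Subsingleton 𝓑
  · infer_instance
  rw [not_subsingleton_iff_nontrivial] at hs
  have hcov : (univ : Set 𝓑) ⊆ ⋃ W ∈ walls 𝓑, {C : 𝓑 | W ⊆ C} := by
    intro C _
    obtain ⟨D, hD⟩ := h𝓑.tree.connected.preconnected.exists_adj_of_nontrivial C
    obtain ⟨x, hx⟩ := hD.2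
    exact mem_biUnion (edge_mem_walls hD.1 hx.1 hx.2) (inter_subset_left : (C ∩ D : Set X) ⊆ C)
  refine countable_univ_iff.1 ((hw.biUnion fun W hW => Set.Finite.countable ?_).mono hcov)
  obtain ⟨⟨x, hx⟩, A, hA, A', hA', hne, rfl⟩ := hW
  refine (Set.toFinite {⟨A, hA⟩, ⟨A', hA'⟩}).subset fun C hC => ?_
  exact eq_or_eq_of_mem_wall h𝓑 (A := ⟨A, hA⟩) (A' := ⟨A', hA'⟩)
    (fun h => hne (congrArg Subtype.val h)) hx.1 hx.2 (hC hx)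

/-! ### Short geodesics cross at most one wall -/

theorem IsGeodesicSegment.continuousOn {c : ℝ → X} {x y : X} (hc : IsGeodesicSegment c x y) :
    ContinuousOn c (Icc 0 (dist x y)) := by
  refine LipschitzOnWith.continuousOn (K := 1) (LipschitzOnWith.of_dist_le_mul fun s hs t ht => ?_)
  rw [hc.isom s hs t ht, Real.dist_eq]
  simp

theorem IsGeodesicSegment.dist_le {c : ℝ → X} {x y : X} (hc : IsGeodesicSegment c x y) {s t : ℝ}
    (hs : s ∈ Icc 0 (dist x y)) (ht : t ∈ Icc 0 (dist x y)) : dist (c s) (c t) ≤ dist x y := by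
  rw [hc.isom s hs t ht, abs_le]
  constructor <;> linarith [hs.1, hs.2, ht.1, ht.2]

/-- A geodesic shorter than `d` meets at most one wall. Merging the two blocks of that wall, if
there is one, turns the blocks into a countable closed partition of the geodesic, which is trivial
by `eq_of_isClosed_fiber`. -/
theorem short_geodesic (h𝓑 : IsTreelike 𝓑) [Countable 𝓑] {d : ℝ}
    (hsep : ∀ W₁ ∈ walls 𝓑, ∀ W₂ ∈ walls 𝓑, W₁ ≠ W₂ → ∀ x ∈ W₁, ∀ y ∈ W₂, d ≤ dist x y)
    {c : ℝ → X} {x y : X} (hc : IsGeodesicSegment c x y) (hd : dist x y < d) :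
    ∃ C C' : 𝓑, x ∈ (C : Set X) ∧ y ∈ (C' : Set X) ∧
      (C = C' ∨ ∃ t ∈ Icc 0 (dist x y), c t ∈ (C : Set X) ∧ c t ∈ (C' : Set X)) := by
  classical
  -- Clamping time extends the geodesic to all of `ℝ`, where `eq_of_isClosed_fiber` applies.
  let k : ℝ → ℝ := fun t => max 0 (min t (dist x y))
  have hk : ∀ t, k t ∈ Icc 0 (dist x y) := fun t =>
    ⟨le_max_left _ _, max_le dist_nonneg (min_le_right _ _)⟩
  have hk' : ∀ t ∈ Icc 0 (dist x y), k t = t := fun t ht => by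
    simp only [k]
    rw [min_eq_left ht.2, max_eq_right ht.1]
  let f : ℝ → X := fun t => c (k t)
  have hf : Continuous f :=
    hc.continuousOn.comp_continuous (by fun_prop) hk
  have hf0 : f 0 = x := by
    simp only [f]
    rw [hk' 0 ⟨le_rfl, dist_nonneg⟩, hc.left]
  have hf1 : f (dist x y) = y := by
    simp only [f]
    rw [hk' _ ⟨dist_nonneg, le_rfl⟩, hc.right]
  choose b hb using fun t => exists_block h𝓑 (f t)
  by_cases hex : ∃ t ∈ Icc 0 (dist x y), ∃ A A' : 𝓑, A ≠ A' ∧ c t ∈ (A : Set X) ∧ c t ∈ (A' : Set X)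
  · obtain ⟨t, ht, A, A', hne, htA, htA'⟩ := hex
    have hone : ∀ s (C D : 𝓑), C ≠ D → f s ∈ (C : Set X) → f s ∈ (D : Set X) →
        s(C, D) = s(A, A') := by
      intro s C D hCD hC hD
      have : (C ∩ D : Set X) = (A ∩ A' : Set X) := by
        by_contra hW
        have := hsep _ (edge_mem_walls hCD hC hD) _ (edge_mem_walls hne htA htA') hW _ ⟨hC, hD⟩ _
          ⟨htA, htA'⟩
        linarith [hc.dist_le (hk s) ht]
      have hs : f s ∈ (A ∩ A' : Set X) := this ▸ ⟨hC, hD⟩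
      exact edge_eq_of_mem_wall h𝓑 hne hCD hs.1 hs.2 hC hD
    have hmem : ∀ s, f s ∈ (A ∪ A' : Set X) := by
      -- The value `none` stands for the merged blocks `A ∪ A'`. By `hone`, any other block `C` has
      -- fibre `f ⁻¹' C`.
      let g : ℝ → Option 𝓑 := fun s => if f s ∈ (A ∪ A' : Set X) then none else some (b s)
      have hg : ∀ i, IsClosed (g ⁻¹' {i}) := by
        rintro (_ | C)
        · have : g ⁻¹' {none} = f ⁻¹' (A ∪ A' : Set X) := by
            ext s
            simp only [g, mem_preimage, mem_singleton_iff]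
            split_ifs with hs <;> simpa using hs
          rw [this]
          exact ((h𝓑.closed _ A.2).union (h𝓑.closed _ A'.2)).preimage hf
        · by_cases hCA : C = A ∨ C = A'
          · have : g ⁻¹' {some C} = ∅ := by
              ext s
              simp only [g, mem_preimage, mem_singleton_iff, mem_empty_iff_false, iff_false]
              split_ifs with hs
              · simp
              · intro h
                obtain rfl := Option.some_injective _ h
                have := hb s
                rcases hCA with h | h
                · exact hs (Or.inl (h ▸ this))
                · exact hs (Or.inr (h ▸ this))
            rw [this]
            exact isClosed_empty
          · have : g ⁻¹' {some C} = f ⁻¹' C := by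
              ext s
              simp only [g, mem_preimage, mem_singleton_iff]
              constructor
              · split_ifs with hs
                · simp
                · intro h
                  obtain rfl := Option.some_injective _ h
                  exact hb s
              · intro hs
                push Not at hCA
                rw [if_neg]
                · congr 1
                  by_contra hbC
                  rcases Sym2.eq_iff.1 (hone s _ _ hbC (hb s) hs) with h | h
                  · exact hCA.2 h.2
                  · exact hCA.1 h.2
                · rintro (h | h)
                  · rcases Sym2.eq_iff.1 (hone s _ _ hCA.1 hs h) with h | h
                    · exact hCA.1 h.1
                    · exact hCA.2 h.1
                  · rcases Sym2.eq_iff.1 (hone s _ _ hCA.2 hs h) with h | h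
                    · exact hCA.1 h.1
                    · exact hCA.2 h.1
            rw [this]
            exact (h𝓑.closed _ C.2).preimage hf
      intro s
      have h1 := eq_of_isClosed_fiber g hg s t
      have h2 : g t = none := by
        have : f t = c t := by simp only [f]; rw [hk' t ht]
        simp only [g]
        exact if_pos (Or.inl (this ▸ htA))
      rw [h2] at h1
      by_contra hs
      simp only [g] at h1
      rw [if_neg hs] at h1
      exact Option.some_ne_none _ h1
    have h0 := hmem 0
    have h1 := hmem (dist x y)
    rw [hf0] at h0
    rw [hf1] at h1
    rcases h0 with h0 | h0 <;> rcases h1 with h1 | h1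
    · exact ⟨A, A, h0, h1, Or.inl rfl⟩
    · exact ⟨A, A', h0, h1, Or.inr ⟨t, ht, htA, htA'⟩⟩
    · exact ⟨A', A, h0, h1, Or.inr ⟨t, ht, htA', htA⟩⟩
    · exact ⟨A', A', h0, h1, Or.inl rfl⟩
  · push Not at hex
    have huniq : ∀ s (C : 𝓑), f s ∈ (C : Set X) → b s = C := fun s C hC => by
      by_contra hne
      exact hex _ (hk s) _ _ hne (hb s) hC
    have hg : ∀ C, IsClosed (b ⁻¹' {C}) := by
      intro C
      have : b ⁻¹' {C} = f ⁻¹' C := by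
        ext s
        exact ⟨fun h => (mem_singleton_iff.1 h) ▸ hb s, fun h => huniq s C h⟩
      rw [this]
      exact (h𝓑.closed _ C.2).preimage hf
    have := eq_of_isClosed_fiber b hg 0 (dist x y)
    exact ⟨b 0, b (dist x y), by simpa only [hf0] using hb 0, by simpa only [hf1] using hb (dist x y),
      Or.inl this⟩

/-! ### The two sides of a wall are closed and convex -/

/-- A short geodesic from a point outside the half to a point of it meets the wall. A limit point
outside the half would thus be a limit of points of the closed wall. -/
theorem isClosed_half (hX : IsCAT0 X) (h𝓑 : IsTreelike 𝓑) [Countable 𝓑] {A A' : 𝓑}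
    (hA : (adjacencyGraph 𝓑).Adj A A') : IsClosed (half A A') := by
  obtain ⟨d, hd, hsep⟩ := h𝓑.separating
  refine isClosed_of_closure_subset fun x hx => ?_
  by_contra hxA
  have hW : x ∈ closure (A ∩ A' : Set X) := by
    rw [Metric.mem_closure_iff] at hx ⊢
    intro ε hε
    obtain ⟨y, hy, hxy⟩ := hx (min ε d) (lt_min hε hd)
    obtain ⟨c, hc⟩ := hX.geodesic x y
    obtain ⟨C, C', hC, hC', h⟩ := short_geodesic h𝓑 hsep hc (hxy.trans_le (min_le_right _ _))
    have hCs : C ∈ side A' A := (side_union h𝓑 A A' C).resolve_left fun h => hxA ⟨C, h, hC⟩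
    have hyW : C' ∈ side A' A → y ∈ (A ∩ A' : Set X) := fun h =>
      mem_wall_of_mem_half h𝓑 hA hy ⟨C', h, hC'⟩
    have hlt := hxy.trans_le (min_le_left _ _)
    rcases h with rfl | ⟨t, ht, htC, htC'⟩
    · exact ⟨y, hyW hCs, hlt⟩
    · rcases side_union h𝓑 A A' C' with h' | h'
      · refine ⟨c t, mem_wall_of_mem_half h𝓑 hA ⟨C', h', htC'⟩ ⟨C, hCs, htC⟩, ?_⟩
        rw [hc.dist_left ht]
        exact ht.2.trans_lt hlt
      · exact ⟨y, hyW h', hlt⟩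
  have hcl : IsClosed (A ∩ A' : Set X) := (h𝓑.closed _ A.2).inter (h𝓑.closed _ A'.2)
  exact hxA (subset_half A A' (hcl.closure_subset hW).1)

theorem exists_mem_wall (hX : IsCAT0 X) (h𝓑 : IsTreelike 𝓑) [Countable 𝓑] {A A' : 𝓑}
    (hA : (adjacencyGraph 𝓑).Adj A A') {f : ℝ → X} {a b : ℝ} (hab : a ≤ b)
    (hf : ContinuousOn f (Icc a b)) (ha : f a ∈ half A A') (hb : f b ∈ half A' A) :
    ∃ t ∈ Icc a b, f t ∈ (A ∩ A' : Set X) := by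
  have hpre : IsPreconnected (f '' Icc a b) := isPreconnected_Icc.image f hf
  obtain ⟨_, ⟨t, ht, rfl⟩, h⟩ := isPreconnected_closed_iff.1 hpre _ _ (isClosed_half hX h𝓑 hA)
    (isClosed_half hX h𝓑 hA.symm) (fun x _ => half_union h𝓑 A A' x)
    ⟨f a, mem_image_of_mem f ⟨le_rfl, hab⟩, ha⟩ ⟨f b, mem_image_of_mem f ⟨hab, le_rfl⟩, hb⟩
  exact ⟨t, ht, mem_wall_of_mem_half h𝓑 hA h.1 h.2⟩

theorem IsGeodesicSegment.subsegment {c : ℝ → X} {x y : X} (hc : IsGeodesicSegment c x y) {a b : ℝ}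
    (ha : 0 ≤ a) (hab : a ≤ b) (hb : b ≤ dist x y) :
    dist (c a) (c b) = b - a ∧ IsGeodesicSegment (fun s => c (a + s)) (c a) (c b) := by
  have hd : dist (c a) (c b) = b - a := by
    rw [hc.isom a ⟨ha, hab.trans hb⟩ b ⟨ha.trans hab, hb⟩, abs_sub_comm,
      abs_of_nonneg (sub_nonneg.2 hab)]
  refine ⟨hd, by simp, by simp [hd], fun s hs t ht => ?_⟩
  rw [hd] at hs ht
  rw [hc.isom _ ⟨by linarith [hs.1], by linarith [hs.2]⟩ _ ⟨by linarith [ht.1], by linarith [ht.2]⟩]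
  congr 1
  ring

theorem IsTreelike.wall_convex (h𝓑 : IsTreelike 𝓑) (A A' : 𝓑) :
    IsGeodesicallyConvex (A ∩ A' : Set X) := fun x hx y hy c hc s hs =>
  ⟨h𝓑.convex _ A.2 x hx.1 y hy.1 c hc s hs, h𝓑.convex _ A'.2 x hx.2 y hy.2 c hc s hs⟩

/-- A geodesic that leaves the half and returns meets the wall before and after, so convexity of the
wall keeps it there in between. -/
theorem half_convex (hX : IsCAT0 X) (h𝓑 : IsTreelike 𝓑) [Countable 𝓑] {A A' : 𝓑}
    (hA : (adjacencyGraph 𝓑).Adj A A') : IsGeodesicallyConvex (half A A') := by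
  intro x hx y hy c hc s hs
  by_contra hsA
  have hs' : c s ∈ half A' A := (half_union h𝓑 A A' (c s)).resolve_left hsA
  obtain ⟨u, hu, huW⟩ := exists_mem_wall hX h𝓑 hA hs.1
    (hc.continuousOn.mono (Icc_subset_Icc le_rfl hs.2)) (by rwa [hc.left]) hs'
  obtain ⟨v, hv, hvW⟩ := exists_mem_wall hX h𝓑 hA.symm hs.2
    (hc.continuousOn.mono (Icc_subset_Icc hs.1 le_rfl)) hs' (by rwa [hc.right])
  rw [inter_comm] at hvW
  obtain ⟨hd, hsub⟩ := hc.subsegment hu.1 (hu.2.trans hv.1) hv.2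
  have := h𝓑.wall_convex A A' _ huW _ hvW _ hsub (s - u)
    ⟨sub_nonneg.2 hu.2, by rw [hd]; linarith [hv.1]⟩
  simp only [add_sub_cancel] at this
  exact hsA (subset_half A A' this.1)

end Sides

/-! ### Itineraries and crossed walls -/

section Itineraries

variable {X : Type u} [MetricSpace X] {𝓑 : Set (Set X)}

theorem GeodesicRay.mem_of_convex (γ : GeodesicRay X) {C : Set X} (hC : IsGeodesicallyConvex C)
    {a b t : ℝ≥0} (ha : γ a ∈ C) (hb : γ b ∈ C) (hat : a ≤ t) (htb : t ≤ b) : γ t ∈ C := by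
  have hab := hat.trans htb
  have := hC _ ha _ hb _ (γ.isGeodesicSegment hab) (t - a) ⟨sub_nonneg.2 hat, by
    rw [γ.dist_eq_of_le hab]
    exact sub_le_sub_right (NNReal.coe_le_coe.2 htb) _⟩
  rwa [← NNReal.coe_sub hat, Real.toNNReal_coe, add_tsub_cancel_of_le hat] at this

theorem GeodesicRay.exists_mem_wall (γ : GeodesicRay X) (hX : IsCAT0 X) (h𝓑 : IsTreelike 𝓑)
    [Countable 𝓑] {A A' : 𝓑} (hA : (adjacencyGraph 𝓑).Adj A A') {a b : ℝ≥0} (hab : a ≤ b)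
    (ha : γ a ∈ half A A') (hb : γ b ∈ half A' A) :
    ∃ t, a ≤ t ∧ t ≤ b ∧ γ t ∈ (A ∩ A' : Set X) := by
  obtain ⟨t, ht, hW⟩ := Treelike.exists_mem_wall hX h𝓑 hA (f := fun s => γ s.toNNReal)
    (NNReal.coe_le_coe.2 hab) (γ.isometry.continuous.comp continuous_real_toNNReal).continuousOn
    (by simpa using ha) (by simpa using hb)
  exact ⟨t.toNNReal, NNReal.le_toNNReal_of_coe_le ht.1, Real.toNNReal_le_iff_le_coe.2 ht.2, hW⟩

theorem GeodesicRay.notMem_half_of_le (γ : GeodesicRay X) (hX : IsCAT0 X) (h𝓑 : IsTreelike 𝓑)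
    [Countable 𝓑] {A A' : 𝓑} (hA : (adjacencyGraph 𝓑).Adj A A') (h₀ : γ 0 ∈ half A A') {s t : ℝ≥0}
    (hst : s ≤ t) (hs : γ s ∉ half A A') : γ t ∉ half A A' := fun ht =>
  hs (γ.mem_of_convex (half_convex hX h𝓑 hA) h₀ ht zero_le hst)

/-- A path that crosses the edge `{A, A'}` ends on its other side. -/
theorem mem_side_of_mem_edges (h𝓑 : IsTreelike 𝓑) {A A' B B' : 𝓑} (hB : B ∈ side A A')
    {P : (adjacencyGraph 𝓑).Walk B B'} (hP : P.IsPath) (he : s(A, A') ∈ P.edges) :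
    B' ∈ side A' A := by
  classical
  refine (side_union h𝓑 A A' B').resolve_left fun hB' => ?_
  -- Otherwise some path from `B` to `B'` avoids the edge, but paths in a tree are unique.
  obtain ⟨Q, hQ⟩ := SimpleGraph.reachable_deleteEdges_iff_exists_walk.1
    (SimpleGraph.Reachable.trans (SimpleGraph.Reachable.symm hB) hB')
  have := (h𝓑.tree.isAcyclic.subsingleton_path B B').elim ⟨P, hP⟩ ⟨Q.bypass, Q.bypass_isPath⟩
  have hPQ : P = Q.bypass := congrArg Subtype.val this
  exact hQ (Q.edges_bypass_subset_edges (hPQ ▸ he))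

theorem exists_dart_eq (h𝓑 : IsTreelike 𝓑) {A A' B B' : 𝓑} (hA : (adjacencyGraph 𝓑).Adj A A')
    (hB : B ∈ side A A') (P : (adjacencyGraph 𝓑).Walk B B') (hB' : B' ∉ side A A') :
    s(A, A') ∈ P.edges := by
  obtain ⟨e, he, h₁, h₂⟩ := P.exists_boundary_dart (side A A') hB hB'
  obtain ⟨h₃, h₄⟩ := edge_eq_of_adj h𝓑 hA h₁ ((side_union h𝓑 A A' _).resolve_left h₂) e.adj
  have := List.mem_map_of_mem (f := SimpleGraph.Dart.edge) he
  have hee : e.edge = s(A, A') := by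
    rw [← h₃, ← h₄]
    rfl
  rwa [hee] at this

theorem edge_eq_of_wall_eq (h𝓑 : IsTreelike 𝓑) {A A' C C' : 𝓑} (hA : (adjacencyGraph 𝓑).Adj A A')
    (hC : (adjacencyGraph 𝓑).Adj C C') (h : (A ∩ A' : Set X) = (C ∩ C' : Set X)) :
    s(C, C') = s(A, A') := by
  obtain ⟨x, hx⟩ := hC.2
  have hx' : x ∈ (A ∩ A' : Set X) := h ▸ hx
  exact edge_eq_of_mem_wall h𝓑 hA.1 hC.1 hx'.1 hx'.2 hx.1 hx.2

/-- The times at which a geodesic ray visits the blocks of its itinerary are unbounded. -/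
theorem exists_time_ge (hX : IsCAT0 X) (h𝓑 : IsTreelike 𝓑) [Countable 𝓑] {γ : GeodesicRay X}
    {b : ℕ → 𝓑} (hb : ∀ i, (adjacencyGraph 𝓑).Adj (b i) (b (i + 1))) {t : ℕ → ℝ≥0}
    (ht : StrictMono t) (hγ : ∀ i, γ (t i) ∈ openBlock 𝓑 (b i)) (T : ℝ≥0) : ∃ i, T ≤ t i := by
  obtain ⟨d, hd, hsep⟩ := h𝓑.separating
  -- Between `t i` and `t (i + 2)` the ray meets two consecutive walls. If they were equal,
  -- convexity would put `γ (t (i + 1))` in a wall, contrary to `openBlock`.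
  have hstep : ∀ i, (t i : ℝ) + d ≤ t (i + 2) := by
    intro i
    have hwall : ∀ j, ∃ s, t j ≤ s ∧ s ≤ t (j + 1) ∧ γ s ∈ (b j ∩ b (j + 1) : Set X) := fun j =>
      γ.exists_mem_wall hX h𝓑 (hb j) (ht j.lt_succ_self).le (subset_half _ _ (hγ j).1)
        (subset_half _ _ (hγ (j + 1)).1)
    obtain ⟨r, hr₁, hr₂, hr⟩ := hwall i
    obtain ⟨s, hs₁, hs₂, hs⟩ := hwall (i + 1)
    have hne : (b i ∩ b (i + 1) : Set X) ≠ (b (i + 1) ∩ b (i + 1 + 1) : Set X) := by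
      intro h
      have hs' : γ s ∈ (b i ∩ b (i + 1) : Set X) := h ▸ hs
      have := γ.mem_of_convex (h𝓑.wall_convex (b i) (b (i + 1))) hr hs' hr₂ hs₁
      exact (hγ (i + 1)).2 ⟨_, ⟨edge_mem_walls (hb i).1 this.1 this.2, inter_subset_right⟩, this⟩
    have := hsep _ (edge_mem_walls (hb i).1 hr.1 hr.2) _
      (edge_mem_walls (hb (i + 1)).1 hs.1 hs.2) hne _ hr _ hs
    rw [γ.dist_eq_of_le (hr₂.trans hs₁)] at this
    have h₁ : (t i : ℝ) ≤ r := hr₁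
    have h₂ : (s : ℝ) ≤ t (i + 2) := hs₂
    linarith
  have hlin : ∀ k : ℕ, k * d ≤ t (2 * k) := by
    intro k
    induction k with
    | zero => simp
    | succ k ih =>
      have := hstep (2 * k)
      push_cast
      rw [mul_add, mul_one]
      linarith
  obtain ⟨k, hk⟩ := exists_nat_ge ((T : ℝ) / d)
  refine ⟨2 * k, NNReal.coe_le_coe.1 (((div_le_iff₀ hd).1 hk).trans (hlin k))⟩

/-- A wall occurs in the itinerary of a geodesic ray if and only if the ray crosses it. -/
theorem mem_occurringWalls_iff (hX : IsCAT0 X) (h𝓑 : IsTreelike 𝓑) [Countable 𝓑] {A A' : 𝓑}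
    (hA : (adjacencyGraph 𝓑).Adj A A') {γ : GeodesicRay X} (h₀ : γ 0 ∈ half A A')
    (hp : ∀ W ∈ walls 𝓑, γ 0 ∉ W) {I : BlockPath 𝓑} (hI : IsItinerary γ I) :
    (A ∩ A' : Set X) ∈ I.occurringWalls ↔ ∃ t, γ t ∉ half A A' := by
  classical
  have hWwall : (A ∩ A' : Set X) ∈ walls 𝓑 := by
    obtain ⟨x, hx⟩ := hA.2
    exact edge_mem_walls hA.1 hx.1 hx.2
  have hstart : ∀ B : 𝓑, γ 0 ∈ (B : Set X) → B ∈ side A A' := fun B hB =>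
    (side_union h𝓑 A A' B).resolve_right fun h =>
      hp _ hWwall (mem_wall_of_mem_half h𝓑 hA h₀ ⟨B, h, hB⟩)
  cases I with
  | @finite B B' P =>
    obtain ⟨-, t₀, ht₀⟩ := hI
    have hB : B ∈ side A A' := hstart B (ht₀ t₀ le_rfl).1
    constructor
    · rintro ⟨C, C', he, hW⟩
      rw [edge_eq_of_wall_eq h𝓑 hA (P.edges_subset_edgeSet he) hW] at he
      by_contra! hall
      -- A ray that stays would have `γ t₀` in the wall, hence already in `A`, and stopping the path
      -- at `A` would shorten it.
      obtain ⟨-, hmem, hpath, hmin⟩ := ht₀ t₀ le_rfl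
      have hB' := mem_side_of_mem_edges h𝓑 hB hpath he
      have hγW := mem_wall_of_mem_half h𝓑 hA (hall t₀) ⟨B', hB', hmem⟩
      have hAP : A ∈ P.support := P.fst_mem_support_of_mem_edges he
      have hne : A ≠ B' := fun h => side_disjoint h𝓑 hA (left_mem_side _ _) (h ▸ hB')
      exact (SimpleGraph.Walk.length_takeUntil_lt_length hAP hne).not_ge
        (hmin A (P.takeUntil A hAP) hγW.1)
    · rintro ⟨t, ht⟩
      have ht' := γ.notMem_half_of_le hX h𝓑 hA h₀ (le_max_left t t₀) ht
      exact ⟨A, A', exists_dart_eq h𝓑 hA hB P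
        fun h => ht' ⟨B', h, (ht₀ _ (le_max_right t t₀)).2.1⟩, rfl⟩
  | infinite b hb =>
    obtain ⟨-, t, -, hmono, ht⟩ := hI
    have hb₀ : b 0 ∈ side A A' := hstart _ (ht 0).1.1
    constructor
    · rintro ⟨i, hW⟩
      have he := edge_eq_of_wall_eq h𝓑 hA (hb i) hW
      -- At this time the ray is in a block beyond the edge and, by `openBlock`, not in the wall.
      refine ⟨t (i + 1), fun hhalf => ?_⟩
      have hmem : s(A, A') ∈ (initialWalk b hb (i + 1)).edges := by
        rw [← he]
        simp [initialWalk, SimpleGraph.Walk.edges_concat]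
      have hside := mem_side_of_mem_edges h𝓑 hb₀ (ht (i + 1)).1.2.2.1 hmem
      have hopen := (ht (i + 1)).2
      have := mem_wall_of_mem_half h𝓑 hA hhalf ⟨_, hside, hopen.1⟩
      exact hopen.2 ⟨_, ⟨hWwall, hW ▸ inter_subset_right⟩, this⟩
    · rintro ⟨T, hT⟩
      obtain ⟨i, hi⟩ := exists_time_ge hX h𝓑 hb hmono (fun i => (ht i).2) T
      have hi' := γ.notMem_half_of_le hX h𝓑 hA h₀ hi hT
      have hbi : b i ∉ side A A' := fun h => hi' ⟨_, h, (ht i).2.1⟩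
      obtain ⟨j, hj, hj'⟩ : ∃ j, b j ∈ side A A' ∧ b (j + 1) ∉ side A A' := by
        by_contra! hall
        exact hbi (Nat.rec hb₀ hall i)
      obtain ⟨h₁, h₂⟩ :=
        edge_eq_of_adj h𝓑 hA hj ((side_union h𝓑 A A' _).resolve_left hj') (hb j)
      exact ⟨j, by rw [h₁, h₂]⟩

end Itineraries

/-! ### The topologies of the boundaries -/

section Topologies

variable {X : Type u} [MetricSpace X] {p : X}

/-- A geodesic ray starting at `p`, as an element of `RayFrom p`. -/
def GeodesicRay.rayFrom (γ : GeodesicRay X) (h : γ 0 = p) : RayFrom p := ⟨γ, h⟩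

theorem isOpen_coneNhd (α : RayFrom p) (r : ℝ≥0) {ε : ℝ} (hε : 0 < ε) : IsOpen (coneNhd α r ε) :=
  TopologicalSpace.isOpen_generateFrom_of_mem ⟨α, r, ε, hε, rfl⟩

theorem continuous_eval (t : ℝ≥0) : Continuous fun γ : RayFrom p => γ.1 t := by
  refine continuous_def.2 fun O hO => isOpen_iff_forall_mem_open.2 fun γ hγ => ?_
  obtain ⟨ε, hε, hball⟩ := Metric.isOpen_iff.1 hO _ hγ
  refine ⟨coneNhd γ t ε, fun δ hδ => hball ?_, isOpen_coneNhd γ t hε, fun s _ => by simpa using hε⟩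
  rw [Metric.mem_ball, dist_comm]
  exact hδ t le_rfl

/-- The boundary point of a geodesic ray from `p`. -/
def visualEndpoint (γ : RayFrom p) : VisualBoundary p := γ.1.endpoint

theorem isOpen_visual_iff {s : Set (VisualBoundary p)} :
    IsOpen s ↔ IsOpen (visualEndpoint (p := p) ⁻¹' s) := isOpen_coinduced

theorem visualEndpoint_injective (hX : IsCAT0 X) :
    Function.Injective (visualEndpoint (p := p)) := fun γ δ h =>
  Subtype.ext (hX.eq_of_endpoint_eq (γ.2.trans δ.2.symm) h)

/-- Since distinct rays from `p` have distinct endpoints, the preimage of the image of `V` is `V`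
itself. -/
theorem isOpen_image_visualEndpoint (hX : IsCAT0 X) {V : Set (RayFrom p)} (hV : IsOpen V) :
    IsOpen (visualEndpoint '' V) := by
  rwa [isOpen_visual_iff, preimage_image_eq _ (visualEndpoint_injective hX)]

/-- The inclusion of the Morse boundary into the visual boundary. -/
def morseInclusion (p : X) (ξ : MorseBoundary p) : VisualBoundary p := ξ.1

/-- It suffices to check each stratum of `M`-Morse rays, where the compact-open topology controls
rays uniformly on `[0, r]`, as a cone neighbourhood requires. -/
theorem continuous_morseInclusion (p : X) : Continuous (morseInclusion p) := by
  refine continuous_iSup_dom.2 fun M => continuous_coinduced_dom.2 ?_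
  have hcone : Continuous fun γ : MorseRayFrom p M => γ.1.rayFrom γ.2.1 := by
    refine continuous_generateFrom_iff.2 ?_
    rintro _ ⟨α, r, ε, hε, rfl⟩
    have heval : Continuous fun x : MorseRayFrom p M × ℝ≥0 => x.1.1 x.2 := by
      have hind : Continuous fun γ : MorseRayFrom p M =>
          (⟨γ.1.toFun, γ.1.isometry.continuous⟩ : C(ℝ≥0, X)) := continuous_induced_dom
      exact (hind.comp continuous_fst).eval continuous_snd
    refine isOpen_iff_mem_nhds.2 fun γ hγ => ?_
    refine (isCompact_Icc (a := (0 : ℝ≥0)) (b := r)).eventually_forall_of_forall_eventually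
      (P := fun (δ : MorseRayFrom p M) t => dist (α.1 t) (δ.1 t) < ε) (x₀ := γ) (fun t ht => ?_)
      |>.mono fun δ hδ t ht => hδ t ⟨zero_le, ht⟩
    have hd : Continuous fun x : MorseRayFrom p M × ℝ≥0 => dist (α.1 x.2) (x.1.1 x.2) :=
      (α.1.isometry.continuous.comp continuous_snd).dist heval
    exact hd.continuousAt.eventually_lt continuousAt_const (hγ t ht.2)
  have hvis : Continuous (visualEndpoint (p := p)) := continuous_coinduced_rng
  exact hvis.comp hcone

end Topologies

/-! ### The cutset property -/

section Cutset

variable {X : Type u} [MetricSpace X] {𝓑 : Set (Set X)}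

/-- If geodesic rays that cross the wall `A ∩ A'` accumulate at a geodesic ray that does not cross
it, then this geodesic ray is asymptotic to a geodesic ray in the wall. -/
theorem exists_ray_in_wall [CompleteSpace X] (hX : IsCAT0 X) (h𝓑 : IsTreelike 𝓑) [Countable 𝓑]
    {A A' : 𝓑} (hA : (adjacencyGraph 𝓑).Adj A A') {p : X} (hp : p ∈ half A A') (γ : RayFrom p)
    (hγ : ∀ t, γ.1 t ∈ half A A')
    (hcl : ∀ V : Set (RayFrom p), IsOpen V → γ ∈ V → ∃ δ ∈ V, ∃ t, δ.1 t ∉ half A A') :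
    ∃ ρ : GeodesicRay X, range ρ ⊆ (A ∩ A' : Set X) ∧ ρ.endpoint = γ.1.endpoint := by
  refine hX.exists_ray_in γ.1 ((h𝓑.closed _ A.2).inter (h𝓑.closed _ A'.2))
    (h𝓑.wall_convex A A') fun R => ?_
  -- If `γ R` is in the wall, `γ` approximates itself. Otherwise nearby rays can be required to
  -- avoid the far half at time `R`, which forces them to cross after `R`.
  by_cases hR : γ.1 R ∈ half A' A
  · exact ⟨γ.1, rfl, by simp, R, le_rfl, mem_wall_of_mem_half h𝓑 hA (hγ R) hR⟩
  obtain ⟨δ, ⟨hδ₁, hδ₂⟩, t, ht⟩ := hcl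
    (coneNhd γ R 1 ∩ (fun δ : RayFrom p => δ.1 R) ⁻¹' (half A' A)ᶜ)
    ((isOpen_coneNhd γ R one_pos).inter
      ((isClosed_half hX h𝓑 hA.symm).isOpen_compl.preimage (continuous_eval R)))
    ⟨fun s _ => by simp, hR⟩
  have hδR : δ.1 R ∈ half A A' := (half_union h𝓑 A A' _).resolve_right hδ₂
  have hRt : R ≤ t := by
    by_contra h
    exact δ.1.notMem_half_of_le hX h𝓑 hA (by rwa [δ.2]) (not_le.1 h).le ht hδR
  obtain ⟨s, hs, -, hsW⟩ := δ.1.exists_mem_wall hX h𝓑 hA hRt hδR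
    ((half_union h𝓑 A A' _).resolve_left ht)
  exact ⟨δ.1, δ.2.trans γ.2.symm, (hδ₁ R le_rfl).le, s, hs, hsW⟩

/-- A preconnected set of boundary points that contains the endpoints of a geodesic ray that
crosses a wall and of one that does not contains a boundary point of the wall. -/
theorem exists_ray_of_isPreconnected [CompleteSpace X] (hX : IsCAT0 X) (h𝓑 : IsTreelike 𝓑)
    [Countable 𝓑] {A A' : 𝓑} (hA : (adjacencyGraph 𝓑).Adj A A') {p : X} (hp : p ∈ half A A')
    {S : Set (VisualBoundary p)} (hS : IsPreconnected S) {γ₁ γ₂ : GeodesicRay X}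
    (h₁ : γ₁ 0 = p) (h₂ : γ₂ 0 = p) (hS₁ : γ₁.endpoint ∈ S) (hS₂ : γ₂.endpoint ∈ S)
    (hcross : ∃ t, γ₁ t ∉ half A A') (hstay : ¬ ∃ t, γ₂ t ∉ half A A') :
    ∃ ρ : GeodesicRay X, range ρ ⊆ (A ∩ A' : Set X) ∧ ρ.endpoint ∈ S := by
  let U : Set (RayFrom p) := {γ | ∃ t, γ.1 t ∉ half A A'}
  have hU : IsOpen U := by
    have : U = ⋃ t, (fun γ : RayFrom p => γ.1 t) ⁻¹' (half A A')ᶜ := by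
      ext γ
      simp [U]
    rw [this]
    exact isOpen_iUnion fun t =>
      (isClosed_half hX h𝓑 hA).isOpen_compl.preimage (continuous_eval t)
  have hUim := isOpen_image_visualEndpoint hX hU
  have hγ₁ : visualEndpoint (γ₁.rayFrom h₁) ∈ visualEndpoint '' U := mem_image_of_mem _ hcross
  have hγ₂ : visualEndpoint (γ₂.rayFrom h₂) ∉ visualEndpoint '' U := by
    rwa [(visualEndpoint_injective hX).mem_set_image]
  by_contra! hnone
  -- Without a boundary point of the wall in `S`, no point of `S` is in the closure of the image of
  -- `U` but outside that image, so two disjoint open sets separate `S`.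
  have hcover : S ⊆ visualEndpoint '' U ∪ (closure (visualEndpoint '' U))ᶜ := by
    intro ξ hξ
    by_contra hξU
    rw [mem_union, not_or, notMem_compl_iff, mem_closure_iff] at hξU
    obtain ⟨hξU, hξcl⟩ := hξU
    -- A class without a representative from `p` would be an isolated point of the coinduced
    -- topology, so it cannot be a limit of classes in the image of `U`.
    obtain ⟨γ, rfl⟩ : ∃ γ, visualEndpoint γ = ξ := by
      by_contra! hγ
      have hopen : IsOpen ({ξ} : Set (VisualBoundary p)) := by
        rw [isOpen_visual_iff]
        convert isOpen_empty
        ext γ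
        simpa using hγ γ
      obtain ⟨η, hη, hηU⟩ := hξcl _ hopen rfl
      exact hξU ((mem_singleton_iff.1 hη) ▸ hηU)
    rw [(visualEndpoint_injective hX).mem_set_image] at hξU
    simp only [U, mem_ofPred_eq, not_exists, not_not] at hξU
    obtain ⟨ρ, hρ, hργ⟩ := exists_ray_in_wall hX h𝓑 hA hp γ hξU fun V hV hγV => by
      obtain ⟨_, ⟨δ, hδ, rfl⟩, hδU⟩ :=
        hξcl _ (isOpen_image_visualEndpoint hX hV) (mem_image_of_mem _ hγV)
      exact ⟨δ, hδ, (visualEndpoint_injective hX).mem_set_image.1 hδU⟩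
    exact hnone ρ hρ (hργ ▸ hξ)
  have hdisj : Disjoint (visualEndpoint '' U) (closure (visualEndpoint '' U))ᶜ :=
    disjoint_compl_right.mono_left subset_closure
  rcases hS.subset_or_subset hUim isClosed_closure.isOpen_compl hdisj hcover with h | h
  · exact hγ₂ (h hS₂)
  · exact h hS₁ (subset_closure hγ₁)

/-- The cutset property for preconnected sets of boundary points. -/
theorem cutset_of_isPreconnected [CompleteSpace X] [TopologicalSpace.SeparableSpace X]
    (hX : IsCAT0 X) (h𝓑 : IsTreelike 𝓑) {p : X} (hp : ∀ W ∈ walls 𝓑, p ∉ W)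
    {S : Set (VisualBoundary p)} (hS : IsPreconnected S) {γ₁ γ₂ : GeodesicRay X}
    (h₁ : γ₁ 0 = p) (h₂ : γ₂ 0 = p) (hS₁ : γ₁.endpoint ∈ S) (hS₂ : γ₂.endpoint ∈ S)
    {I₁ I₂ : BlockPath 𝓑} (hI₁ : IsItinerary γ₁ I₁) (hI₂ : IsItinerary γ₂ I₂)
    {W : Set X} (hW : W ∈ walls 𝓑) (hxor : Xor (W ∈ I₁.occurringWalls) (W ∈ I₂.occurringWalls)) :
    ∃ ρ : GeodesicRay X, range ρ ⊆ W ∧ ρ.endpoint ∈ S := by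
  have := h𝓑.countable
  obtain ⟨A, A', hA, hpA, rfl⟩ : ∃ A A' : 𝓑, (adjacencyGraph 𝓑).Adj A A' ∧ p ∈ half A A' ∧
      W = (A ∩ A' : Set X) := by
    obtain ⟨hne, B, hB, B', hB', hBB', rfl⟩ := hW
    have hadj : (adjacencyGraph 𝓑).Adj ⟨B, hB⟩ ⟨B', hB'⟩ :=
      ⟨fun h => hBB' (congrArg Subtype.val h), hne⟩
    rcases half_union h𝓑 ⟨B, hB⟩ ⟨B', hB'⟩ p with h | h
    · exact ⟨_, _, hadj, h, rfl⟩
    · exact ⟨_, _, hadj.symm, h, inter_comm _ _⟩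
  rw [mem_occurringWalls_iff hX h𝓑 hA (by rwa [h₁]) (by rwa [h₁]) hI₁,
    mem_occurringWalls_iff hX h𝓑 hA (by rwa [h₂]) (by rwa [h₂]) hI₂] at hxor
  rcases hxor with ⟨hc, hs⟩ | ⟨hc, hs⟩
  · exact exists_ray_of_isPreconnected hX h𝓑 hA hpA hS h₁ h₂ hS₁ hS₂ hc hs
  · exact exists_ray_of_isPreconnected hX h𝓑 hA hpA hS h₂ h₁ hS₂ hS₁ hc hs

end Cutset

end Treelike

end

theorem proposition3p2 {X : Type*} [MetricSpace X] [CompleteSpace X]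
    [TopologicalSpace.SeparableSpace X] (hX : Treelike.IsCAT0 X)
    (𝓑 : Set (Set X)) (h𝓑 : Treelike.IsTreelike 𝓑)
    (p : X) (hp : ∀ W ∈ Treelike.walls 𝓑, p ∉ W) :
    -- the visual boundary
    (∀ κ : Set (Treelike.VisualBoundary p), Treelike.IsConnectedComponent κ →
      ∀ γ₁ γ₂ : Treelike.GeodesicRay X, γ₁ 0 = p → γ₂ 0 = p →
        γ₁.endpoint ≠ γ₂.endpoint → γ₁.endpoint ∈ κ → γ₂.endpoint ∈ κ →
      ∀ I₁ I₂ : Treelike.BlockPath 𝓑, Treelike.IsItinerary γ₁ I₁ → Treelike.IsItinerary γ₂ I₂ →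
      ∀ W ∈ Treelike.walls 𝓑, Xor (W ∈ I₁.occurringWalls) (W ∈ I₂.occurringWalls) →
        ∃ γ : Treelike.GeodesicRay X, Set.range γ ⊆ W ∧ γ.endpoint ∈ κ) ∧
    -- the Morse boundary
    (∀ κ : Set (Treelike.MorseBoundary p), Treelike.IsConnectedComponent κ →
      ∀ γ₁ γ₂ : Treelike.GeodesicRay X, γ₁ 0 = p → γ₂ 0 = p →
        γ₁.endpoint ≠ γ₂.endpoint →
        γ₁.endpoint ∈ Subtype.val '' κ → γ₂.endpoint ∈ Subtype.val '' κ →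
      ∀ I₁ I₂ : Treelike.BlockPath 𝓑, Treelike.IsItinerary γ₁ I₁ → Treelike.IsItinerary γ₂ I₂ →
      ∀ W ∈ Treelike.walls 𝓑, Xor (W ∈ I₁.occurringWalls) (W ∈ I₂.occurringWalls) →
        ∃ γ : Treelike.GeodesicRay X, Set.range γ ⊆ W ∧ γ.endpoint ∈ Subtype.val '' κ) := by
  constructor
  · rintro _ ⟨y, rfl⟩ γ₁ γ₂ h₁ h₂ _ hκ₁ hκ₂ I₁ I₂ hI₁ hI₂ W hW hxor
    exact Treelike.cutset_of_isPreconnected hX h𝓑 hp isPreconnected_connectedComponent h₁ h₂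
      hκ₁ hκ₂ hI₁ hI₂ hW hxor
  · rintro _ ⟨y, rfl⟩ γ₁ γ₂ h₁ h₂ _ hκ₁ hκ₂ I₁ I₂ hI₁ hI₂ W hW hxor
    -- `Subtype.val '' κ` is the image of `κ` under `morseInclusion`, so the class found there is
    -- automatically in the Morse boundary.
    exact Treelike.cutset_of_isPreconnected hX h𝓑 hp
      (isPreconnected_connectedComponent.image (Treelike.morseInclusion p)
        (Treelike.continuous_morseInclusion p).continuousOn)
      h₁ h₂ hκ₁ hκ₂ hI₁ hI₂ hW hxor
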